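/- Let $1\le k\le N$, let $f_1,\dots,f_N$ be nonconstant real affine forms on $\mathbb R^k$ with pairwise distinct zero hyperplanes $H_j=\{f_j=0\}$ in generic position (any $k$ of them meet in exactly one point, any $k+1$ have empty intersection), let $l_j=f_j-f_j(0)$, let $\alpha_j>0$ be weights, and put $\alpha_U=\sum_{j\in U}\alpha_j$ for $U\subset\{1,\dots,N\}$. A vertex is a $k$-element set $X\subset\{1,\dots,N\}$, identified with the point $\bigcap_{j\in X}H_j$; $\mathcal X$ is the set of vertices. Let $f_0$ be a linear form on $\mathbb R^k$ that takes distinct values at distinct vertices and is nonconstant on every line $\bigcap_{j\in U}H_j$, $|U|=k-1$. For a vertex $X$ and $j\in X$ let $e_{X\setminus\{j\}}$ be the unique vector with $l_i(e_{X\setminus\{j\}})=0$ for $i\in X\setminus\{j\}$ and $f_0(e_{X\setminus\{j\}})=1$; for $\rho\in\mathbb C$, $|\rho|=1$, put $$\mathcal C_X^\rho=\Big\{X+\rho\sum_{j\in X}a_je_{X\setminus\{j\}}\ :\ a_j>0\Big\}\subset\mathbb C^k,\qquad \mathcal C_X^+=\mathcal C_X^1\subset\mathbb R^k .$$ Let $\mathcal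 D^+$ be the set of connected components of $\mathbb R^k\setminus\bigcup_jH_j$ on which $f_0$ is bounded from below, and let $\Delta_X$ be the unique component that has $X$ in its boundary and on which $f_0>f_0(X)$. For components $\Delta,\Delta'$ let $\mathcal H(\Delta,\Delta')$ be the set of indices $j$ such that $H_j$ separates $\Delta$ from $\Delta'$. Put $$\Omega_{X'}=\Big(\prod_{j=1}^N|f_j|^{\alpha_j}\Big)\,\frac{df_{j_1}}{f_{j_1}}\wedge\dots\wedge\frac{df_{j_k}}{f_{j_k}},\qquad X'=\{j_1,\dots,j_k\},$$ where $X'$ is ordered so that $df_{j_1}\wedge\dots\wedge df_{j_k}$ is positively oriented, and for $\Delta\in\mathcal D^+$, $\operatorname{Re}\lambda>0$, $$I_{\Delta,X'}(\lambda)=\int_\Delta e^{-\lambda f_0}\Omega_{X'},\qquad I_\Delta(\lambda)=(I_{\Delta,X'}(\lambda))_{X'\in\mathcal X}.$$ For $|\rho|=1$, $\operatorname{Im}\rho\ne0$, $\operatorname{Re}(\rho\lambda)>0$, let $I^\rho_{X,X'}(\lambda)=\int_{\mathcal C_X^\rho}e^{-\lambda f_0}\Omega_{X'}$, where $\mathcal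 C_X^\rho$ is oriented through the map $x\mapsto X+\rho(x-X)$ from $\mathcal C_X^+$ and the determination of $\Omega_{X'}$ is the analytic extension of the real form $\Omega_{X'}|_{\Delta_X}$ to a simply connected domain in the complement of the complexified hyperplanes containing $\Delta_X$ and all the cones $\mathcal C_X^{\rho'}$, $|\rho'|=1$, with $\operatorname{Im}\rho'$ of the same sign as $\operatorname{Im}\rho$. Let $I^{+}_{X}(\lambda)=(I^{+}_{X,X'}(\lambda))_{X'\in\mathcal X}$ (respectively $I^-_X(\lambda)$) denote the common value of the vectors $(I^\rho_{X,X'}(\lambda))_{X'\in\mathcal X}$ over all $\rho$ with $|\rho|=1$, $\operatorname{Re}(\rho\lambda)>0$ and $\operatorname{Im}\rho<0$ (respectively $\operatorname{Im}\rho>0$). Then for every vertex $X$ and every $\lambda$ with $\operatorname{Re}\lambda>0$ the integrals $I_{\Delta,X'}(\lambda)$, $\Delta\in\mathcal D^+$, and $I^\rho_{X,X'}(\lambda)$ above converge absolutely, the values $I^\rho_{X,X'}(\lambda)$ do not depend on $\rho$ within each of the two half-planes, and $$I^+_X(\lambda)=\sum_{\Delta\in\mathcal D^+,\ \Delta\subset\mathcal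 C_X^+}\eta(X,\Delta)\,I_\Delta(\lambda),\qquad I^-_X(\lambda)=\sum_{\Delta\in\mathcal D^+,\ \Delta\subset\mathcal C_X^+}\overline{\eta(X,\Delta)}\,I_\Delta(\lambda),$$ where $\eta(X,\Delta_X)=1$ and $\eta(X,\Delta)=e^{\pi i\,\alpha_{\mathcal H(\Delta,\Delta_X)}}$ for $\Delta\ne\Delta_X$. -/

import Mathlib

open scoped BigOperators Topology

noncomputable section

namespace HypArr

/-- Real affine forms `f 0, …, f (N-1)` on `ℝ^k` whose zero sets are hyperplanes in generic position,
positive weights `α`, and a linear form `f₀` in general position with respect to them. -/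
structure Arrangement (k N : ℕ) where
  f : Fin N → ((Fin k → ℝ) →ᵃ[ℝ] ℝ)
  f₀ : (Fin k → ℝ) →ₗ[ℝ] ℝ
  α : Fin N → ℝ
  k_pos : 0 < k
  k_le : k ≤ N
  α_pos : ∀ j, 0 < α j
  nonconst : ∀ j, (f j).linear ≠ 0
  distinct : ∀ i j, i ≠ j → {x | f i x = 0} ≠ {x | f j x = 0}
  meet : ∀ X : Finset (Fin N), X.card = k → ∃! p, ∀ j ∈ X, f j p = 0
  no_meet : ∀ Y : Finset (Fin N), Y.card = k + 1 → ¬ ∃ p, ∀ j ∈ Y, f j p = 0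
  f₀_distinct : ∀ X Y : Finset (Fin N), X.card = k → Y.card = k → X ≠ Y →
    ∀ p q, (∀ j ∈ X, f j p = 0) → (∀ j ∈ Y, f j q = 0) → f₀ p ≠ f₀ q
  f₀_nonconst : ∀ U : Finset (Fin N), U.card + 1 = k →
    ∃ p q, (∀ j ∈ U, f j p = 0) ∧ (∀ j ∈ U, f j q = 0) ∧ f₀ p ≠ f₀ q

namespace Arrangement

variable {k N : ℕ} (A : Arrangement k N)

/-- The linear form `l_j = f_j - f_j(0)`. -/
def l (j : Fin N) : (Fin k → ℝ) →ₗ[ℝ] ℝ := (A.f j).linear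

theorem f_add (j : Fin N) (p v : Fin k → ℝ) : A.f j (p + v) = A.f j p + A.l j v := by
  have h := (A.f j).map_vadd p v
  simp only [vadd_eq_add] at h
  rw [add_comm p v, h, add_comm]; rfl

theorem f_continuous (j : Fin N) : Continuous (A.f j) :=
  (A.f j).continuous_of_finiteDimensional

/-- Vertices, as `k`-element sets of indices. -/
abbrev Vertex (_A : Arrangement k N) : Type := {X : Finset (Fin N) // X.card = k}

/-- A vertex as a point of `ℝ^k`. -/
def pt (X : A.Vertex) : Fin k → ℝ := (A.meet X.1 X.2).choose

theorem f_pt (X : A.Vertex) {j : Fin N} (hj : j ∈ X.1) : A.f j (A.pt X) = 0 :=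
  (A.meet X.1 X.2).choose_spec.1 j hj

theorem eq_zero_of_l (X : A.Vertex) (v : Fin k → ℝ) (h : ∀ j ∈ X.1, A.l j v = 0) : v = 0 := by
  have h2 := (A.meet X.1 X.2).choose_spec.2 (A.pt X + v) (by
    intro j hj
    show A.f j (A.pt X + v) = 0
    rw [A.f_add, A.f_pt X hj, h j hj, add_zero])
  have h3 : A.pt X + v = A.pt X := h2
  simpa using h3

theorem existsUnique_edgeVec (U : Finset (Fin N)) (hU : U.card + 1 = k) :
    ∃! v : Fin k → ℝ, (∀ j ∈ U, A.l j v = 0) ∧ A.f₀ v = 1 := by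
  classical
  obtain ⟨p, q, hp, hq, hpq⟩ := A.f₀_nonconst U hU
  have hd : A.f₀ (q - p) ≠ 0 := by
    rw [map_sub]; exact sub_ne_zero.2 (Ne.symm hpq)
  have hl : ∀ j ∈ U, A.l j (q - p) = 0 := by
    intro j hj
    have := A.f_add j p (q - p)
    rw [add_sub_cancel, hp j hj, hq j hj] at this
    linarith
  set v := (A.f₀ (q - p))⁻¹ • (q - p) with hv
  have hv0 : ∀ j ∈ U, A.l j v = 0 := by
    intro j hj; rw [hv, map_smul, hl j hj, smul_zero]
  have hv1 : A.f₀ v = 1 := by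
    rw [hv, map_smul, smul_eq_mul, inv_mul_cancel₀ hd]
  refine ⟨v, ⟨hv0, hv1⟩, ?_⟩
  rintro w ⟨hw0, hw1⟩
  obtain ⟨j, hj⟩ : ∃ j, j ∉ U := by
    by_contra! hcon
    have h1 : U = Finset.univ := Finset.eq_univ_iff_forall.2 hcon
    have h2 := A.k_le
    rw [h1, Finset.card_univ, Fintype.card_fin] at hU
    omega
  let X : A.Vertex := ⟨insert j U, by rw [Finset.card_insert_of_notMem hj, hU]⟩
  have hc : A.l j v ≠ 0 := by
    intro h
    have : v = 0 := A.eq_zero_of_l X v (by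
      intro i hi
      rcases Finset.mem_insert.1 hi with rfl | hi
      · exact h
      · exact hv0 i hi)
    rw [this, map_zero] at hv1
    exact zero_ne_one hv1
  have hu : w - (A.l j w / A.l j v) • v = 0 := A.eq_zero_of_l X _ (by
    intro i hi
    rw [map_sub, map_smul, smul_eq_mul]
    rcases Finset.mem_insert.1 hi with rfl | hi
    · field_simp; ring
    · rw [hw0 i hi, hv0 i hi]; ring)
  have hw : w = (A.l j w / A.l j v) • v := sub_eq_zero.1 hu
  have h1 : A.l j w / A.l j v = 1 := by
    have := congrArg A.f₀ hw
    rw [map_smul, hw1, hv1, smul_eq_mul, mul_one] at this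
    exact this.symm
  rw [hw, h1, one_smul]

/-- The vector `e_U`, `U = X \ {j}`: it directs the line `⋂_{i ∈ U} H_i` and `f₀ e_U = 1`. -/
def e (X : A.Vertex) (j : {j // j ∈ X.1}) : Fin k → ℝ :=
  (A.existsUnique_edgeVec (X.1.erase j.1) (by
    rw [Finset.card_erase_add_one j.2]; exact X.2)).choose

/-- The open cone `C_X^+ ⊂ ℝ^k`. -/
def cone (X : A.Vertex) : Set (Fin k → ℝ) :=
  {x | ∃ a : {j // j ∈ X.1} → ℝ, (∀ j, 0 < a j) ∧ x = A.pt X + ∑ j, a j • A.e X j}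

/-- The inclusion `ℝ^k ⊂ ℂ^k`. -/
def toC (x : Fin k → ℝ) : Fin k → ℂ := fun i => (x i : ℂ)

/-- The cone `C_X^ρ ⊂ ℂ^k`. -/
def coneC (X : A.Vertex) (ρ : ℂ) : Set (Fin k → ℂ) :=
  {z | ∃ a : {j // j ∈ X.1} → ℝ, (∀ j, 0 < a j) ∧
    z = toC (A.pt X) + ρ • ∑ j, (a j : ℂ) • toC (A.e X j)}

/-- The map `F_ρ : x ↦ X + ρ (x - X)`. -/
def F (X : A.Vertex) (ρ : ℂ) (x : Fin k → ℝ) : Fin k → ℂ :=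
  toC (A.pt X) + ρ • toC (x - A.pt X)

theorem image_F_cone (X : A.Vertex) (ρ : ℂ) : A.F X ρ '' A.cone X = A.coneC X ρ := by
  have key : ∀ a : {j // j ∈ X.1} → ℝ, A.F X ρ (A.pt X + ∑ j, a j • A.e X j) =
      toC (A.pt X) + ρ • ∑ j, (a j : ℂ) • toC (A.e X j) := by
    intro a
    ext i
    simp [F, toC, Finset.sum_apply]
  ext z
  constructor
  · rintro ⟨x, ⟨a, ha, rfl⟩, rfl⟩
    exact ⟨a, ha, key a⟩
  · rintro ⟨a, ha, rfl⟩
    exact ⟨_, ⟨a, ha, rfl⟩, key a⟩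

/-- The complement of the hyperplanes. -/
def compl : Set (Fin k → ℝ) := {x | ∀ j, A.f j x ≠ 0}

/-- The arrangement domains. -/
def domains : Set (Set (Fin k → ℝ)) :=
  {Δ | ∃ x ∈ A.compl, Δ = connectedComponentIn A.compl x}

/-- The arrangement domains on which `f₀` is bounded from below. -/
def domainsPlus : Set (Set (Fin k → ℝ)) := {Δ ∈ A.domains | BddBelow (A.f₀ '' Δ)}

theorem component_eq {x y : Fin k → ℝ} (h : ∀ j, 0 < A.f j x * A.f j y) :
    connectedComponentIn A.compl x = connectedComponentIn A.compl y := by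
  have hs : segment ℝ x y ⊆ A.compl := by
    rintro z ⟨s, t, hs, ht, hst, rfl⟩ j hz
    have e1 : A.f j (s • x + t • y) = s * A.f j x + t * A.f j y := by
      have h1 : s • x + t • y = x + t • (y - x) := by
        have : s = 1 - t := by linarith
        rw [this, smul_sub, sub_smul, one_smul]; abel
      have h2 : A.l j (y - x) = A.f j y - A.f j x := by
        have := A.f_add j x (y - x)
        rw [add_sub_cancel] at this; linarith
      rw [h1, A.f_add, map_smul, h2, smul_eq_mul]
      have : s = 1 - t := by linarith
      rw [this]; ring
    rw [e1] at hz
    have hj := h j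
    have hx : A.f j x ≠ 0 := fun h0 => by rw [h0, zero_mul] at hj; exact lt_irrefl _ hj
    have h3 : s * (A.f j x * A.f j x) + t * (A.f j x * A.f j y) = 0 := by
      linear_combination (A.f j x) * hz
    have hxx : 0 < A.f j x * A.f j x := mul_self_pos.2 hx
    rcases hs.eq_or_lt with rfl | hs'
    · have : t = 1 := by linarith
      rw [this] at h3; linarith
    · have := mul_pos hs' hxx
      have := mul_nonneg ht hj.le
      linarith
  have hpre : IsPreconnected (segment ℝ x y) := (convex_segment x y).isPreconnected
  have hy := hpre.subset_connectedComponentIn (left_mem_segment ℝ x y) hs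
    (right_mem_segment ℝ x y)
  exact connectedComponentIn_eq hy

theorem sign_of_mem {x y : Fin k → ℝ} (hx : x ∈ A.compl)
    (hy : y ∈ connectedComponentIn A.compl x) (j : Fin N) : 0 < A.f j x * A.f j y := by
  have hxm := mem_connectedComponentIn hx
  have hsub := connectedComponentIn_subset A.compl x
  have hpre : IsPreconnected (A.f j '' connectedComponentIn A.compl x) :=
    isPreconnected_connectedComponentIn.image _ (A.f_continuous j).continuousOn
  have hz : (0 : ℝ) ∉ A.f j '' connectedComponentIn A.compl x := by
    rintro ⟨z, hz, h0⟩
    exact hsub hz j h0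
  have hoc := hpre.ordConnected
  have m1 := Set.mem_image_of_mem (A.f j) hxm
  have m2 := Set.mem_image_of_mem (A.f j) hy
  rcases lt_or_gt_of_ne (hsub hxm j) with h1 | h1 <;>
    rcases lt_or_gt_of_ne (hsub hy j) with h2 | h2
  · exact mul_pos_of_neg_of_neg h1 h2
  · exact absurd (hoc.out m1 m2 ⟨h1.le, h2.le⟩) hz
  · exact absurd (hoc.out m2 m1 ⟨h2.le, h1.le⟩) hz
  · exact mul_pos h1 h2

theorem domains_finite : A.domains.Finite := by
  classical
  let g : A.domains → (Fin N → Bool) := fun D j => decide (0 < A.f j D.2.choose)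
  have hg : Function.Injective g := by
    intro D E h
    have hD := D.2.choose_spec
    have hE := E.2.choose_spec
    apply Subtype.ext
    rw [hD.2, hE.2]
    apply A.component_eq
    intro j
    have hj := congrFun h j
    simp only [g, decide_eq_decide] at hj
    rcases lt_or_gt_of_ne (hD.1 j) with h1 | h1 <;>
      rcases lt_or_gt_of_ne (hE.1 j) with h2 | h2
    · exact mul_pos_of_neg_of_neg h1 h2
    · exact absurd (hj.2 h2) (not_lt.2 h1.le)
    · exact absurd (hj.1 h1) (not_lt.2 h2.le)
    · exact mul_pos h1 h2
  have := Finite.of_injective g hg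
  exact Set.toFinite _


theorem e_spec (X : A.Vertex) (j : {j // j ∈ X.1}) :
    (∀ i ∈ X.1, i ≠ j.1 → A.l i (A.e X j) = 0) ∧ A.f₀ (A.e X j) = 1 := by
  have h := (A.existsUnique_edgeVec (X.1.erase j.1) (by
    rw [Finset.card_erase_add_one j.2]; exact X.2)).choose_spec.1
  exact ⟨fun i hi hij => h.1 i (Finset.mem_erase.2 ⟨hij, hi⟩), h.2⟩

theorem l_e_ne (X : A.Vertex) (j : {j // j ∈ X.1}) : A.l j.1 (A.e X j) ≠ 0 := by
  intro h
  have h0 : A.e X j = 0 := A.eq_zero_of_l X _ (by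
    intro i hi
    by_cases hij : i = j.1
    · rw [hij]; exact h
    · exact (A.e_spec X j).1 i hi hij)
  have h1 := (A.e_spec X j).2
  rw [h0, map_zero] at h1
  exact zero_ne_one h1

theorem l_sum (X : A.Vertex) (a : {j // j ∈ X.1} → ℝ) (i : {j // j ∈ X.1}) :
    A.l i.1 (∑ j, a j • A.e X j) = a i * A.l i.1 (A.e X i) := by
  classical
  rw [map_sum, Finset.sum_eq_single i]
  · rw [map_smul, smul_eq_mul]
  · intro j _ hj
    rw [map_smul, (A.e_spec X j).1 i.1 i.2 (fun h => hj (Subtype.ext h.symm)), smul_zero]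
  · intro h; exact absurd (Finset.mem_univ i) h

theorem f₀_sum (X : A.Vertex) (a : {j // j ∈ X.1} → ℝ) :
    A.f₀ (∑ j, a j • A.e X j) = ∑ j, a j := by
  rw [map_sum]
  refine Finset.sum_congr rfl fun j _ => ?_
  rw [map_smul, (A.e_spec X j).2, smul_eq_mul, mul_one]

theorem exists_coord (X : A.Vertex) (x : Fin k → ℝ) :
    ∃ a : {j // j ∈ X.1} → ℝ, x = A.pt X + ∑ j, a j • A.e X j := by
  refine ⟨fun j => A.f j.1 x / A.l j.1 (A.e X j), ?_⟩
  have h := A.eq_zero_of_l X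
    (x - A.pt X - ∑ j, (A.f j.1 x / A.l j.1 (A.e X j)) • A.e X j) (by
      intro i hi
      have h1 := A.l_sum X (fun j => A.f j.1 x / A.l j.1 (A.e X j)) ⟨i, hi⟩
      have h2 := A.f_add i (A.pt X) (x - A.pt X)
      rw [add_sub_cancel, A.f_pt X hi, zero_add] at h2
      rw [map_sub, h1, ← h2]
      have := A.l_e_ne X ⟨i, hi⟩
      field_simp
      ring)
  rw [sub_eq_zero] at h
  rw [← h, add_sub_cancel]

theorem f_pt_ne (X : A.Vertex) {i : Fin N} (hi : i ∉ X.1) : A.f i (A.pt X) ≠ 0 := by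
  classical
  intro h
  refine A.no_meet (insert i X.1) (by rw [Finset.card_insert_of_notMem hi, X.2])
    ⟨A.pt X, fun j hj => ?_⟩
  rcases Finset.mem_insert.1 hj with rfl | hj
  · exact h
  · exact A.f_pt X hj

theorem eventually_sign (X : A.Vertex) :
    ∀ᶠ x in 𝓝 (A.pt X), ∀ i, i ∉ X.1 → 0 < A.f i x * A.f i (A.pt X) := by
  rw [Filter.eventually_all]
  intro i
  by_cases hi : i ∈ X.1
  · exact Filter.Eventually.of_forall fun _ h => absurd hi h
  · have hc : Continuous fun x => A.f i x * A.f i (A.pt X) :=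
      (A.f_continuous i).mul continuous_const
    have := hc.continuousAt.eventually_const_lt (mul_self_pos.2 (A.f_pt_ne X hi))
    exact this.mono fun _ h _ => h

theorem tendsto_ray (X : A.Vertex) (d : Fin k → ℝ) :
    Filter.Tendsto (fun t : ℝ => A.pt X + t • d) (𝓝[>] 0) (𝓝 (A.pt X)) := by
  have hc : Continuous fun t : ℝ => A.pt X + t • d := by fun_prop
  have := hc.tendsto 0
  simp only [zero_smul, add_zero] at this
  exact this.mono_left nhdsWithin_le_nhds

theorem eventually_ray (X : A.Vertex) (d : Fin k → ℝ) :
    ∀ᶠ t : ℝ in 𝓝[>] 0, ∀ i, i ∉ X.1 → 0 < A.f i (A.pt X + t • d) * A.f i (A.pt X) :=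
  (A.tendsto_ray X d).eventually (A.eventually_sign X)

/-- `Δ` is a domain with `X` in its boundary, on which `f₀ - f₀(X) > 0`. -/
def IsBaseDomain (X : A.Vertex) (Δ : Set (Fin k → ℝ)) : Prop :=
  Δ ∈ A.domains ∧ A.pt X ∈ frontier Δ ∧ ∀ x ∈ Δ, 0 < A.f₀ x - A.f₀ (A.pt X)

theorem pos_of_mul {a b c : ℝ} (h1 : 0 < a * c) (h2 : 0 < b * c) : 0 < a * b := by
  have h3 : 0 < (a * b) * (c * c) := by
    have := mul_pos h1 h2
    nlinarith
  have hc : c ≠ 0 := fun h => by rw [h, mul_zero] at h1; exact lt_irrefl _ h1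
  exact pos_of_mul_pos_left h3 (mul_self_nonneg c)

theorem pt_mem_frontier (X : A.Vertex) (x : Fin k → ℝ)
    (h : A.pt X ∈ closure (connectedComponentIn A.compl x)) :
    A.pt X ∈ frontier (connectedComponentIn A.compl x) := by
  refine ⟨h, fun hi => ?_⟩
  have h1 := connectedComponentIn_subset _ _ (interior_subset hi)
  obtain ⟨j, hj⟩ : X.1.Nonempty := Finset.card_pos.1 (by rw [X.2]; exact A.k_pos)
  exact h1 j (A.f_pt X hj)

theorem baseDomain_aux (X : A.Vertex) :
    ∃ a : {j // j ∈ X.1} → ℝ, (∀ j, 0 < a j) ∧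
      (∀ i, i ∉ X.1 → 0 < A.f i (A.pt X + ∑ j, a j • A.e X j) * A.f i (A.pt X)) ∧
      A.pt X + ∑ j, a j • A.e X j ∈ A.compl ∧
      A.IsBaseDomain X (connectedComponentIn A.compl (A.pt X + ∑ j, a j • A.e X j)) ∧
      ∀ Δ, A.IsBaseDomain X Δ →
        Δ = connectedComponentIn A.compl (A.pt X + ∑ j, a j • A.e X j) := by
  classical
  obtain ⟨t, ht, ht0⟩ := ((A.eventually_ray X (∑ j, (1 : ℝ) • A.e X j)).and
    self_mem_nhdsWithin).exists
  have ht0 : 0 < t := ht0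
  have hsc : ∀ s : ℝ, s • ∑ j, (1 : ℝ) • A.e X j = ∑ j, (fun _ => s) j • A.e X j := by
    intro s; rw [Finset.smul_sum]; simp
  set p := A.pt X + ∑ j, (fun _ => t) j • A.e X j with hp
  have hpt : ∀ i, i ∉ X.1 → 0 < A.f i p * A.f i (A.pt X) := by
    intro i hi; have := ht i hi; rwa [hsc] at this
  have hfX : ∀ (a : {j // j ∈ X.1} → ℝ) (i : {j // j ∈ X.1}),
      A.f i.1 (A.pt X + ∑ j, a j • A.e X j) = a i * A.l i.1 (A.e X i) := by
    intro a i; rw [A.f_add, A.f_pt X i.2, zero_add, A.l_sum]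
  have hll : ∀ i : {j // j ∈ X.1}, 0 < A.l i.1 (A.e X i) * A.l i.1 (A.e X i) :=
    fun i => mul_self_pos.2 (A.l_e_ne X i)
  have hpc : p ∈ A.compl := by
    intro j hj
    by_cases hjX : j ∈ X.1
    · have := hfX (fun _ => t) ⟨j, hjX⟩
      rw [← hp, hj] at this
      exact (mul_ne_zero ht0.ne' (A.l_e_ne X ⟨j, hjX⟩)) this.symm
    · have := hpt j hjX; rw [hj, zero_mul] at this; exact lt_irrefl _ this
  have hsame : ∀ a : {j // j ∈ X.1} → ℝ, (∀ j, 0 < a j) →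
      (∀ i, i ∉ X.1 → 0 < A.f i (A.pt X + ∑ j, a j • A.e X j) * A.f i (A.pt X)) →
      ∀ j, 0 < A.f j p * A.f j (A.pt X + ∑ j, a j • A.e X j) := by
    intro a ha hs j
    by_cases hjX : j ∈ X.1
    · have h1 := hfX (fun _ => t) ⟨j, hjX⟩
      have h2 := hfX a ⟨j, hjX⟩
      rw [hp]
      simp only at h1 h2
      rw [h1, h2]
      have := mul_pos (mul_pos ht0 (ha ⟨j, hjX⟩)) (hll ⟨j, hjX⟩)
      nlinarith
    · exact pos_of_mul (hpt j hjX) (hs j hjX)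
  refine ⟨fun _ => t, fun _ => ht0, hpt, hpc, ⟨⟨p, hpc, rfl⟩, ?_, ?_⟩, ?_⟩
  · apply A.pt_mem_frontier
    refine mem_closure_of_tendsto (A.tendsto_ray X (∑ j, (1 : ℝ) • A.e X j)) ?_
    filter_upwards [A.eventually_ray X (∑ j, (1 : ℝ) • A.e X j), self_mem_nhdsWithin] with s hs hs0
    have hs0 : 0 < s := hs0
    rw [hsc] at hs ⊢
    have hc := A.component_eq (hsame (fun _ => s) (fun _ => hs0) hs)
    rw [← hp, hc]
    apply mem_connectedComponentIn
    intro j hj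
    have := hsame (fun _ => s) (fun _ => hs0) hs j
    rw [hj, mul_zero] at this
    exact lt_irrefl _ this
  · intro x hx
    obtain ⟨a, rfl⟩ := A.exists_coord X x
    rw [map_add, A.f₀_sum, add_sub_cancel_left]
    have hpos : ∀ j, 0 < a j := by
      intro j
      have h1 := A.sign_of_mem hpc hx j.1
      rw [hp, hfX, hfX] at h1
      have h2 : 0 < a j * (t * (A.l j.1 (A.e X j) * A.l j.1 (A.e X j))) := by
        nlinarith
      exact pos_of_mul_pos_left h2 (mul_pos ht0 (hll j)).le
    obtain ⟨j, hj⟩ : X.1.Nonempty := Finset.card_pos.1 (by rw [X.2]; exact A.k_pos)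
    exact Finset.sum_pos (fun j _ => hpos j) ⟨⟨j, hj⟩, Finset.mem_univ _⟩
  · rintro Δ ⟨⟨x, hx, rfl⟩, hfr, hf₀⟩
    obtain ⟨y, hyΔ, hyev⟩ := ((mem_closure_iff_frequently.1 hfr.1).and_eventually
      (A.eventually_sign X)).exists
    have hyc := connectedComponentIn_subset _ _ hyΔ
    have hxy := connectedComponentIn_eq hyΔ
    rw [hxy] at hf₀ ⊢
    obtain ⟨b, rfl⟩ := A.exists_coord X y
    have hb0 : ∀ j, b j ≠ 0 := by
      intro j h
      have := hfX b j
      rw [h, zero_mul] at this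
      exact hyc j.1 this
    have hb : ∀ j, 0 < b j := by
      intro i
      by_contra hneg
      have hneg : b i < 0 := lt_of_le_of_ne (not_lt.1 hneg) (hb0 i)
      obtain ⟨M, hM0, hM⟩ : ∃ M : ℝ, 0 ≤ M ∧ ∑ j, b j + M * b i < 0 := by
        refine ⟨(|∑ j, b j| + 1) / (-b i), div_nonneg (by positivity) (by linarith), ?_⟩
        have : (|∑ j, b j| + 1) / (-b i) * b i = -(|∑ j, b j| + 1) := by
          have := hneg.ne
          field_simp
        rw [this]
        have := le_abs_self (∑ j, b j)
        linarith
      let c : {j // j ∈ X.1} → ℝ := fun j => b j + (if j = i then M * b i else 0)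
      have hcb : ∀ j, 0 < b j * c j := by
        intro j
        simp only [c]
        have := mul_self_pos.2 (hb0 j)
        split_ifs with h
        · rw [h] at this ⊢
          nlinarith
        · simpa using this
      have hcs : ∑ j, c j < 0 := by
        simp only [c, Finset.sum_add_distrib, Finset.sum_ite_eq', Finset.mem_univ, if_true]
        exact hM
      obtain ⟨s, hs, hs0⟩ := ((A.eventually_ray X (∑ j, c j • A.e X j)).and
        self_mem_nhdsWithin).exists
      have hs0 : 0 < s := hs0
      have hss : s • ∑ j, c j • A.e X j = ∑ j, (fun j => s * c j) j • A.e X j := by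
        rw [Finset.smul_sum]; simp [mul_smul]
      rw [hss] at hs
      have hsig : ∀ j, 0 < A.f j (A.pt X + ∑ j, b j • A.e X j) *
          A.f j (A.pt X + ∑ j, (fun j => s * c j) j • A.e X j) := by
        intro j
        by_cases hjX : j ∈ X.1
        · have h1 := hfX b ⟨j, hjX⟩
          have h2 := hfX (fun j => s * c j) ⟨j, hjX⟩
          simp only at h1 h2
          rw [h1, h2]
          have := mul_pos (mul_pos hs0 (hcb ⟨j, hjX⟩)) (hll ⟨j, hjX⟩)
          nlinarith
        · exact pos_of_mul (hyev j hjX) (hs j hjX)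
      have hmem : A.pt X + ∑ j, (fun j => s * c j) j • A.e X j ∈
          connectedComponentIn A.compl (A.pt X + ∑ j, b j • A.e X j) := by
        rw [A.component_eq hsig]
        apply mem_connectedComponentIn
        intro j hj
        have := hsig j
        rw [hj, mul_zero] at this
        exact lt_irrefl _ this
      have h3 := hf₀ _ hmem
      rw [map_add, A.f₀_sum, add_sub_cancel_left, ← Finset.mul_sum] at h3
      have := mul_neg_of_pos_of_neg hs0 hcs
      linarith
    exact (A.component_eq (hsame b hb hyev)).symm

theorem existsUnique_baseDomain (X : A.Vertex) : ∃! Δ, A.IsBaseDomain X Δ := by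
  obtain ⟨a, -, -, -, h1, h2⟩ := A.baseDomain_aux X
  exact ⟨_, h1, h2⟩

/-- The domain `Δ_X`. -/
def baseDomain (X : A.Vertex) : Set (Fin k → ℝ) := (A.existsUnique_baseDomain X).choose

theorem baseDomain_spec (X : A.Vertex) : A.IsBaseDomain X (A.baseDomain X) :=
  (A.existsUnique_baseDomain X).choose_spec.1

/-- The complex extension of `f_j` to `ℂ^k`; its zero set is the complexified hyperplane. -/
def fC (j : Fin N) (z : Fin k → ℂ) : ℂ :=
  (A.f j 0 : ℂ) + ∑ i, z i * (A.l j (Pi.single i 1) : ℂ)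

/-- The complex extension of `f₀` to `ℂ^k`. -/
def f₀C (z : Fin k → ℂ) : ℂ := ∑ i, z i * (A.f₀ (Pi.single i 1) : ℂ)

/-- The coefficient of `df_{j_1} ∧ ⋯ ∧ df_{j_k}` with respect to `dz_1 ∧ ⋯ ∧ dz_k`, where
`{j_1, …, j_k} = X` is ordered so that this coefficient is positive. -/
def vol (X : A.Vertex) : ℝ :=
  |Matrix.det (Matrix.of fun a b : Fin k =>
    A.l (X.1.orderEmbOfFin X.2 a) (Pi.single b 1))|

/-- The coefficient of the real form `Ω_X = (∏ |f_j|^{α_j}) ω_X` with respect to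
`dx_1 ∧ ⋯ ∧ dx_k`, where `ω_X = df_{j_1} / f_{j_1} ∧ ⋯ ∧ df_{j_k} / f_{j_k}`. -/
def Ω (X : A.Vertex) (x : Fin k → ℝ) : ℝ :=
  (∏ j, |A.f j x| ^ A.α j) * (A.vol X / ∏ j ∈ X.1, A.f j x)

/-- The integrand of `I_{Δ,X}(lam)`. -/
def integrand (X : A.Vertex) (lam : ℂ) (x : Fin k → ℝ) : ℂ :=
  Complex.exp (-lam * (A.f₀ x : ℂ)) * (A.Ω X x : ℂ)

/-- The vector `I_Δ(lam) = (I_{Δ,X}(lam))_X`. -/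
def IΔ (Δ : Set (Fin k → ℝ)) (lam : ℂ) : A.Vertex → ℂ := fun X =>
  ∫ x in Δ, A.integrand X lam x

/-- Unit complex numbers with negative imaginary part. -/
def lowerArc : Set ℂ := {ρ | ‖ρ‖ = 1 ∧ ρ.im < 0}

/-- Unit complex numbers with positive imaginary part. -/
def upperArc : Set ℂ := {ρ | ‖ρ‖ = 1 ∧ 0 < ρ.im}

/-- `G` is the coefficient (with respect to `dz_1 ∧ ⋯ ∧ dz_k`) of an analytic extension of the real
form `Ω_{X'}` from `Δ_X` to a simply connected domain of the complement of the complexified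
hyperplanes that contains the cones `C_X^ρ`, `ρ ∈ R`. -/
def IsExtension (R : Set ℂ) (X X' : A.Vertex) (G : (Fin k → ℂ) → ℂ) : Prop :=
  ∃ D : Set (Fin k → ℂ), IsOpen D ∧ SimplyConnectedSpace D ∧
    (∀ z ∈ D, ∀ j, A.fC j z ≠ 0) ∧
    (∀ ρ ∈ R, A.coneC X ρ ⊆ D) ∧ (∀ x ∈ A.baseDomain X, toC x ∈ D) ∧
    DifferentiableOn ℂ G D ∧ ∀ x ∈ A.baseDomain X, G (toC x) = (A.Ω X' x : ℂ)

theorem fC_toC_add (j : Fin N) (p v : Fin k → ℝ) (ρ : ℂ) :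
    A.fC j (toC p + ρ • toC v) = (A.f j p : ℂ) + ρ * (A.l j v : ℂ) := by
  have hl : ∀ w : Fin k → ℝ, A.l j w = ∑ i, w i * A.l j (Pi.single i 1) := by
    intro w
    conv_lhs => rw [← Finset.univ_sum_single w, map_sum]
    refine Finset.sum_congr rfl fun i _ => ?_
    have : (Pi.single i (w i) : Fin k → ℝ) = w i • Pi.single i 1 := by
      rw [← Pi.single_smul, smul_eq_mul, mul_one]
    rw [this, map_smul, smul_eq_mul]
  have hf : A.f j p = A.f j 0 + A.l j p := by
    have := A.f_add j 0 p
    rwa [zero_add] at this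
  rw [hf, hl p, hl v, fC]
  push_cast
  rw [Finset.mul_sum, add_assoc, ← Finset.sum_add_distrib]
  congr 1
  refine Finset.sum_congr rfl fun i _ => ?_
  simp only [toC, Pi.add_apply, Pi.smul_apply, smul_eq_mul]
  ring

theorem fC_toC (j : Fin N) (p : Fin k → ℝ) : A.fC j (toC p) = (A.f j p : ℂ) := by
  have := A.fC_toC_add j p 0 0
  simpa using this

theorem differentiableAt_prod {ι : Type*} {s : Finset ι} {g : ι → (Fin k → ℂ) → ℂ}
    {z : Fin k → ℂ} (h : ∀ i ∈ s, DifferentiableAt ℂ (g i) z) :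
    DifferentiableAt ℂ (fun z => ∏ i ∈ s, g i z) z := by
  classical
  induction s using Finset.induction_on with
  | empty => simp
  | insert i s hi ih =>
    simp only [Finset.prod_insert hi]
    exact (h i (Finset.mem_insert_self i s)).mul
      (ih fun j hj => h j (Finset.mem_insert_of_mem hj))

theorem exists_isExtension (R : Set ℂ) (hR : ∀ ρ ∈ R, ρ.im ≠ 0) (X X' : A.Vertex) :
    ∃ G, A.IsExtension R X X' G := by
  obtain ⟨a, ha, hs, hpc, hbase, -⟩ := A.baseDomain_aux X
  set p := A.pt X + ∑ j, a j • A.e X j with hp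
  have hΔ : A.baseDomain X = connectedComponentIn A.compl p :=
    (A.existsUnique_baseDomain X).unique (A.baseDomain_spec X) hbase
  have hc0 : ∀ j, (A.f j p : ℂ) ≠ 0 := fun j => Complex.ofReal_ne_zero.2 (hpc j)
  have hdiff : ∀ j, Differentiable ℂ (A.fC j) := by
    intro j; unfold fC; fun_prop
  let D : Set (Fin k → ℂ) := {z | ∀ j, A.fC j z / (A.f j p : ℂ) ∈ Complex.slitPlane}
  have hDne : ∀ z ∈ D, ∀ j, A.fC j z ≠ 0 := by
    intro z hz j h
    have := hz j
    rw [h, zero_div] at this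
    exact Complex.slitPlane_ne_zero this rfl
  have hDreal : ∀ x ∈ A.baseDomain X, ∀ j, 0 < A.f j x / A.f j p := by
    intro x hx j
    rw [hΔ] at hx
    have h1 := A.sign_of_mem hpc hx j
    have h2 : A.f j x / A.f j p = (A.f j p * A.f j x) / (A.f j p * A.f j p) := by
      have := hpc j
      field_simp
    rw [h2]
    exact div_pos h1 (mul_self_pos.2 (hpc j))
  have hpD : toC p ∈ D := by
    intro j
    rw [A.fC_toC, div_self (hc0 j)]
    exact Complex.one_mem_slitPlane
  refine ⟨fun z => (∏ j, ((|A.f j p| ^ A.α j : ℝ) : ℂ) *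
      (A.fC j z / (A.f j p : ℂ)) ^ (A.α j : ℂ)) * ((A.vol X' : ℂ) * (∏ j ∈ X'.1, A.fC j z)⁻¹),
    D, ?_, ?_, hDne, ?_, ?_, ?_, ?_⟩
  · have : D = ⋂ j, (fun z => A.fC j z / (A.f j p : ℂ)) ⁻¹' Complex.slitPlane := by
      ext z; simp [D]
    rw [this]
    exact isOpen_iInter_of_finite fun j =>
      Complex.isOpen_slitPlane.preimage ((hdiff j).continuous.div_const _)
  · have hstar : StarConvex ℝ (toC p) D := by
      intro z hz s t hs ht hst j
      have hz' : A.fC j (s • toC p + t • z) / (A.f j p : ℂ) =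
          s • (1 : ℂ) + t • (A.fC j z / (A.f j p : ℂ)) := by
        have h1 : A.fC j (s • toC p + t • z) = s * A.fC j (toC p) + t * A.fC j z := by
          have h2 : (s : ℂ) = 1 - t := by
            rw [← Complex.ofReal_one, ← Complex.ofReal_sub]; congr 1; linarith
          simp only [fC, Pi.add_apply, Pi.smul_apply, Complex.real_smul, add_mul, mul_assoc,
            Finset.sum_add_distrib, ← Finset.mul_sum, mul_add]
          rw [h2]; ring
        rw [h1, A.fC_toC, Complex.real_smul, Complex.real_smul]
        have := hc0 j
        field_simp
      rw [hz']
      exact Complex.starConvex_one_slitPlane (hz j) hs ht hst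
    have := hstar.contractibleSpace ⟨_, hpD⟩
    infer_instance
  · rintro ρ hρ z ⟨b, hb, rfl⟩ j
    have hz : (toC (A.pt X) + ρ • ∑ j, (b j : ℂ) • toC (A.e X j) : Fin k → ℂ) =
        toC (A.pt X) + ρ • toC (∑ j, b j • A.e X j) := by
      ext i; simp [toC, Finset.sum_apply]
    rw [hz, A.fC_toC_add]
    by_cases hj : j ∈ X.1
    · have h1 := A.l_sum X b ⟨j, hj⟩
      have h2 : A.f j p = a ⟨j, hj⟩ * A.l j (A.e X ⟨j, hj⟩) := by
        rw [hp, A.f_add, A.f_pt X hj, zero_add]; exact A.l_sum X a ⟨j, hj⟩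
      have h3 := A.l_e_ne X ⟨j, hj⟩
      simp only at h1 h3
      have h4 : ((A.f j (A.pt X) : ℝ) + ρ * (A.l j (∑ j, b j • A.e X j) : ℝ) : ℂ) /
          (A.f j p : ℂ) = ρ * ((b ⟨j, hj⟩ / a ⟨j, hj⟩ : ℝ) : ℂ) := by
        rw [A.f_pt X hj, h1, h2]
        have h5 : (A.l j (A.e X ⟨j, hj⟩) : ℂ) ≠ 0 := Complex.ofReal_ne_zero.2 h3
        have h6 : (a ⟨j, hj⟩ : ℂ) ≠ 0 := Complex.ofReal_ne_zero.2 (ha _).ne'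
        push_cast
        field_simp
        ring
      rw [h4]
      right
      rw [Complex.im_mul_ofReal]
      exact mul_ne_zero (hR ρ hρ) (div_pos (hb _) (ha _)).ne'
    · have h4 : ((A.f j (A.pt X) : ℝ) + ρ * (A.l j (∑ j, b j • A.e X j) : ℝ) : ℂ) /
          (A.f j p : ℂ) = ((A.f j (A.pt X) / A.f j p : ℝ) : ℂ) +
            ρ * ((A.l j (∑ j, b j • A.e X j) / A.f j p : ℝ) : ℂ) := by
        push_cast
        ring
      rw [h4]
      by_cases h0 : A.l j (∑ j, b j • A.e X j) / A.f j p = 0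
      · left
        rw [h0]
        simp only [Complex.ofReal_zero, mul_zero, add_zero, Complex.ofReal_re]
        have h2 : A.f j (A.pt X) / A.f j p =
            (A.f j p * A.f j (A.pt X)) / (A.f j p * A.f j p) := by
          have := hpc j
          field_simp
        rw [h2]
        exact div_pos (hs j hj) (mul_self_pos.2 (hpc j))
      · right
        rw [Complex.add_im, Complex.ofReal_im, zero_add, Complex.im_mul_ofReal]
        exact mul_ne_zero (hR ρ hρ) h0
  · intro x hx j
    rw [A.fC_toC, ← Complex.ofReal_div]
    exact Complex.ofReal_mem_slitPlane.2 (hDreal x hx j)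
  · intro z hz
    apply DifferentiableAt.differentiableWithinAt
    have h1 : ∀ j, DifferentiableAt ℂ (A.fC j) z := fun j => (hdiff j) z
    have h2 : DifferentiableAt ℂ (fun z => ∏ j ∈ X'.1, A.fC j z) z :=
      differentiableAt_prod fun j _ => h1 j
    have h3 : DifferentiableAt ℂ (fun z => ∏ j, ((|A.f j p| ^ A.α j : ℝ) : ℂ) *
        (A.fC j z / (A.f j p : ℂ)) ^ (A.α j : ℂ)) z :=
      differentiableAt_prod fun j _ => (differentiableAt_const _).mul
        (((h1 j).mul_const (A.f j p : ℂ)⁻¹).cpow (differentiableAt_const _) (hz j))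
    exact h3.mul ((h2.inv (Finset.prod_ne_zero_iff.2 fun j _ => hDne z hz j)).const_mul _)
  · intro x hx
    simp only [A.fC_toC, Ω, div_eq_mul_inv]
    simp only [← div_eq_mul_inv (Complex.ofReal _) (Complex.ofReal _)]
    push_cast
    congr 1
    refine Finset.prod_congr rfl fun j _ => ?_
    have h1 := hDreal x hx j
    rw [← Complex.ofReal_div, ← Complex.ofReal_cpow h1.le, ← Complex.ofReal_mul,
      ← Real.mul_rpow (abs_nonneg _) h1.le]
    congr 2
    have h2 : A.f j x = A.f j p * (A.f j x / A.f j p) := by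
      have := hpc j
      field_simp
    conv_rhs => rw [h2, abs_mul, abs_of_pos h1]

/-- The coefficient of the determination of `Ω_{X'}` on the cones `C_X^ρ`, `ρ ∈ R`. -/
def ΩC (R : Set ℂ) (X X' : A.Vertex) : (Fin k → ℂ) → ℂ := by
  classical
  exact if h : ∃ G, A.IsExtension R X X' G then h.choose else 0

/-- The pullback of `e^{-lam f₀} Ω_{X'}` under `F_ρ : C_X^+ → C_X^ρ` (as `F_ρ^* dz_i = ρ dx_i`). -/
def integrandρ (R : Set ℂ) (ρ : ℂ) (X X' : A.Vertex) (lam : ℂ) (x : Fin k → ℝ) : ℂ :=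
  Complex.exp (-lam * A.f₀C (A.F X ρ x)) * A.ΩC R X X' (A.F X ρ x) * ρ ^ k

/-- The integral `I_{X,X'}^ρ(lam)` over the cone `C_X^ρ`. -/
def Iρ (R : Set ℂ) (ρ : ℂ) (X X' : A.Vertex) (lam : ℂ) : ℂ :=
  ∫ x in A.cone X, A.integrandρ R ρ X X' lam x

/-- `c` is the common value of the (absolutely convergent) integrals `I_{X,X'}^ρ(lam)` over all
`ρ ∈ R` with `Re (ρ lam) > 0`. -/
def IsCommonValue (R : Set ℂ) (X X' : A.Vertex) (lam c : ℂ) : Prop :=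
  ∀ ρ ∈ R, 0 < (ρ * lam).re →
    MeasureTheory.IntegrableOn (A.integrandρ R ρ X X' lam) (A.cone X) ∧
    A.Iρ R ρ X X' lam = c

/-- The common value of the integrals `I_{X,X'}^ρ(lam)`, `ρ ∈ R`, `Re (ρ lam) > 0`. -/
def commonValue (R : Set ℂ) (X X' : A.Vertex) (lam : ℂ) : ℂ := by
  classical
  exact if h : ∃ c, A.IsCommonValue R X X' lam c then h.choose else 0

/-- The vector `I_X^+(lam) = (I_{X,X'}^+(lam))_{X'}`. -/
def IPlus (X : A.Vertex) (lam : ℂ) : A.Vertex → ℂ := fun X' => A.commonValue lowerArc X X' lam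

/-- The vector `I_X^-(lam) = (I_{X,X'}^-(lam))_{X'}`. -/
def IMinus (X : A.Vertex) (lam : ℂ) : A.Vertex → ℂ := fun X' => A.commonValue upperArc X X' lam

/-- The indices of the hyperplanes separating `Δ` from `Δ'`. -/
def sep (Δ Δ' : Set (Fin k → ℝ)) : Finset (Fin N) := by
  classical
  exact Finset.univ.filter fun j => ∀ x ∈ Δ, ∀ y ∈ Δ', A.f j x * A.f j y < 0

/-- `α_U = ∑_{j ∈ U} α_j`. -/
def αSum (U : Finset (Fin N)) : ℝ := ∑ j ∈ U, A.α j

/-- The coefficient `η(X, Δ)`. -/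
def η (X : A.Vertex) (Δ : Set (Fin k → ℝ)) : ℂ := by
  classical
  exact if Δ = A.baseDomain X then 1
    else Complex.exp (Real.pi * Complex.I * (A.αSum (A.sep Δ (A.baseDomain X)) : ℂ))

theorem coneDomains_finite (X : A.Vertex) : {Δ ∈ A.domainsPlus | Δ ⊆ A.cone X}.Finite :=
  A.domains_finite.subset fun _ h => h.1.1

/-- The domains `Δ` of `domainsPlus` contained in `C_X^+`. -/
def coneDomains (X : A.Vertex) : Finset (Set (Fin k → ℝ)) := (A.coneDomains_finite X).toFinset

end Arrangement
end HypArr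
end

/-!
On `Δ` and on `C_X^+` the integrand is dominated by an integrable function: a product of powers
`|f_j|^s`, `s > -1`, against exponential decay, the zero hyperplanes being in general position. For
`w` in an open half-plane, `x ↦ X + w (x - X)` sends `C_X^+` into a region where the principal
powers of `± f_j` define the determination of `Ω`, and pulling back gives integrals over the fixed
cone `C_X^+` that depend holomorphically on `w`. They are invariant under `w ↦ r w`, `r > 0`, by
homogeneity of the cone, hence constant in `w` as long as they converge. Letting `w → 1`, each `f_j`
that changes sign between `Δ_X` and `Δ` contributes `e^{± π i α_j}`, and the product of these
factors is `η(X, Δ)` or its conjugate.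
-/

noncomputable section

namespace HypArr

open MeasureTheory Filter Set

/-! ### Integrability of powers of linear forms against exponential decay -/

theorem integrable_abs_rpow_mul_exp_neg_mul_abs {s c : ℝ} (hs : -1 < s) (hc : 0 < c) :
    Integrable fun y : ℝ => |y| ^ s * Real.exp (-c * |y|) := by
  have hpos : IntegrableOn (fun y : ℝ => |y| ^ s * Real.exp (-c * |y|)) (Ioi 0) := by
    have h := integrableOn_rpow_mul_exp_neg_mul_rpow hs one_pos hc
    simp only [Real.rpow_one] at h
    exact h.congr_fun (fun y hy => by simp only [abs_of_pos (mem_Ioi.1 hy)]) measurableSet_Ioi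
  have hneg : IntegrableOn (fun y : ℝ => |y| ^ s * Real.exp (-c * |y|)) (Iic 0) := by
    rw [integrableOn_Iic_iff_integrableOn_Iio]
    simpa using hpos.comp_neg
  rw [← integrableOn_univ, ← Iic_union_Ioi]
  exact hneg.union hpos

section Pi

variable {ι : Type*} [Fintype ι] {s : ι → ℝ} {c : ℝ}

theorem integrable_exp_neg_mul_norm_mul_prod_abs_rpow (hs : ∀ i, -1 < s i) (hc : 0 < c) :
    Integrable fun y : ι → ℝ => Real.exp (-c * ‖y‖) * ∏ i, |y i| ^ s i := by
  set d : ℝ := c / (Fintype.card ι + 1) with hd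
  have hd0 : 0 < d := by positivity
  have hprod : Integrable fun y : ι → ℝ => ∏ i, |y i| ^ s i * Real.exp (-d * |y i|) :=
    Integrable.fintype_prod fun i => integrable_abs_rpow_mul_exp_neg_mul_abs (hs i) hd0
  refine hprod.mono' (by fun_prop) (Eventually.of_forall fun y => ?_)
  have hsum : d * ∑ i, |y i| ≤ c * ‖y‖ := calc
    d * ∑ i, |y i| ≤ d * ((Fintype.card ι + 1) * ‖y‖) := by
      refine mul_le_mul_of_nonneg_left ?_ hd0.le
      have h := Finset.sum_le_card_nsmul Finset.univ (fun i => |y i|) ‖y‖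
        fun i _ => norm_le_pi_norm y i
      rw [Finset.card_univ, nsmul_eq_mul] at h
      linarith [norm_nonneg y]
    _ = c * ‖y‖ := by rw [hd]; field_simp
  rw [Real.norm_of_nonneg (by positivity), Finset.prod_mul_distrib, ← Real.exp_sum,
    ← Finset.mul_sum, mul_comm]
  exact mul_le_mul_of_nonneg_left (Real.exp_le_exp.2 (by linarith)) (by positivity)

theorem integrable_exp_neg_mul_norm_mul_prod_abs_linearMap_rpow (hs : ∀ i, -1 < s i) (hc : 0 < c)
    {L : (ι → ℝ) →ₗ[ℝ] (ι → ℝ)} (hL : Function.Injective L) (p : ι → ℝ) :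
    Integrable fun x : ι → ℝ => Real.exp (-c * ‖x‖) * ∏ i, |L (x - p) i| ^ s i := by
  have hdet : LinearMap.det L ≠ 0 := (LinearMap.isUnit_iff_isUnit_det L |>.1
    (LinearMap.isUnit_iff_ker_eq_bot L |>.2 (LinearMap.ker_eq_bot.2 hL))).ne_zero
  have hLc : Continuous L := L.continuous_of_finiteDimensional
  set K : ℝ := ‖LinearMap.toContinuousLinearMap L‖ + 1 with hK
  have hK0 : 0 < K := by positivity
  have hcomp : Integrable fun x : ι → ℝ =>
      Real.exp (-(c / K) * ‖L x‖) * ∏ i, |L x i| ^ s i := by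
    have h := (integrable_exp_neg_mul_norm_mul_prod_abs_rpow hs (div_pos hc hK0)).smul_measure
      (c := ENNReal.ofReal |(LinearMap.det L)⁻¹|) ENNReal.ofReal_ne_top
    rw [← Real.map_linearMap_volume_pi_eq_smul_volume_pi hdet] at h
    exact h.comp_measurable hLc.measurable
  have : Measurable fun x : ι → ℝ => L (x - p) :=
    hLc.measurable.comp (measurable_id.sub_const p)
  refine ((hcomp.comp_sub_right p).const_mul (Real.exp (c * ‖p‖))).mono'
    (Measurable.aestronglyMeasurable (by fun_prop)) (Eventually.of_forall fun x => ?_)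
  have hnorm : c / K * ‖L (x - p)‖ ≤ c * (‖x‖ + ‖p‖) := calc
    c / K * ‖L (x - p)‖ ≤ c / K * (K * (‖x‖ + ‖p‖)) := by
      gcongr
      refine ((LinearMap.toContinuousLinearMap L).le_opNorm (x - p)).trans ?_
      gcongr
      · linarith [hK]
      · exact norm_sub_le x p
    _ = c * (‖x‖ + ‖p‖) := by field_simp
  rw [Real.norm_of_nonneg (by positivity), ← mul_assoc, ← Real.exp_add]
  gcongr
  linarith

end Pi

/-! ### Elementary real estimates -/

theorem exists_one_add_rpow_le_mul_exp {m ε : ℝ} (hm : 0 ≤ m) (hε : 0 < ε) :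
    ∃ C, 0 ≤ C ∧ ∀ t, 0 ≤ t → (1 + t) ^ m ≤ C * Real.exp (ε * t) := by
  set δ := ε / (m + 1) with hδ
  have hδ0 : 0 < δ := by positivity
  refine ⟨(1 + δ⁻¹) ^ m, by positivity, fun t ht => ?_⟩
  have hlin : 1 + t ≤ (1 + δ⁻¹) * Real.exp (δ * t) := calc
    1 + t ≤ (1 + δ⁻¹) * (δ * t + 1) := by
      have : (1 + δ⁻¹) * (δ * t + 1) = 1 + t + (δ * t + δ⁻¹) := by field_simp; ring
      rw [this]
      have : 0 ≤ δ * t + δ⁻¹ := by positivity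
      linarith
    _ ≤ (1 + δ⁻¹) * Real.exp (δ * t) := by gcongr; exact Real.add_one_le_exp _
  calc (1 + t) ^ m ≤ ((1 + δ⁻¹) * Real.exp (δ * t)) ^ m := by gcongr
    _ = (1 + δ⁻¹) ^ m * Real.exp (δ * m * t) := by
      rw [Real.mul_rpow (by positivity) (by positivity), ← Real.exp_mul]
      ring_nf
    _ ≤ (1 + δ⁻¹) ^ m * Real.exp (ε * t) := by
      gcongr
      rw [hδ, div_mul_eq_mul_div, div_le_iff₀ (by positivity)]
      linarith

theorem rpow_le_rpow_max_mul_rpow_min {a t b : ℝ} (ha : 0 < a) (hat : a ≤ t) (htb : t ≤ b)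
    (s : ℝ) : t ^ s ≤ b ^ max s 0 * a ^ min s 0 := by
  have ht : 0 < t := ha.trans_le hat
  calc t ^ s = t ^ max s 0 * t ^ min s 0 := by rw [← Real.rpow_add ht, max_add_min, add_zero]
    _ ≤ b ^ max s 0 * a ^ min s 0 := mul_le_mul
      (Real.rpow_le_rpow ht.le htb (le_max_right _ _))
      (Real.rpow_le_rpow_of_nonpos ha hat (min_le_right _ _)) (by positivity)
      (Real.rpow_nonneg (ht.le.trans htb) _)

theorem exists_exp_mul_prod_rpow_le {ι : Type*} [Fintype ι] (s : ι → ℝ) {κ M c : ℝ} (hκ : 0 < κ)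
    (hM : 0 ≤ M) (hc : 0 < c) :
    ∃ C, 0 ≤ C ∧ ∀ (t : ℝ) (a z : ι → ℝ), 0 ≤ t → (∀ i, 0 < a i) → (∀ i, κ * a i ≤ z i) →
      (∀ i, z i ≤ M * (1 + t)) →
      Real.exp (-c * t) * ∏ i, z i ^ s i ≤
        C * (Real.exp (-(c / 2) * t) * ∏ i, a i ^ min (s i) 0) := by
  obtain ⟨G, hG, hgrowth⟩ := exists_one_add_rpow_le_mul_exp (m := ∑ i, max (s i) 0)
    (Finset.sum_nonneg fun i _ => le_max_right (s i) 0) (half_pos hc)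
  refine ⟨(∏ i, M ^ max (s i) 0) * (∏ i, κ ^ min (s i) 0) * G, by positivity,
    fun t a z ht ha hlow hup => ?_⟩
  have hz : ∀ i, 0 < z i := fun i => (mul_pos hκ (ha i)).trans_le (hlow i)
  have hprod : ∏ i, z i ^ s i ≤ (∏ i, M ^ max (s i) 0) * (1 + t) ^ (∑ i, max (s i) 0) *
      ((∏ i, κ ^ min (s i) 0) * ∏ i, a i ^ min (s i) 0) := calc
    ∏ i, z i ^ s i ≤ ∏ i, (M * (1 + t)) ^ max (s i) 0 * (κ * a i) ^ min (s i) 0 :=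
      Finset.prod_le_prod (fun i _ => Real.rpow_nonneg (hz i).le _) fun i _ =>
        rpow_le_rpow_max_mul_rpow_min (mul_pos hκ (ha i)) (hlow i) (hup i) _
    _ = _ := by
      rw [Real.rpow_sum_of_pos (by positivity), ← Finset.prod_mul_distrib,
        ← Finset.prod_mul_distrib, ← Finset.prod_mul_distrib]
      refine Finset.prod_congr rfl fun i _ => ?_
      rw [Real.mul_rpow hM (by positivity), Real.mul_rpow hκ.le (ha i).le]
  have ha' : ∀ i, 0 ≤ a i := fun i => (ha i).le
  calc Real.exp (-c * t) * ∏ i, z i ^ s i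
      ≤ Real.exp (-c * t) * ((∏ i, M ^ max (s i) 0) * (G * Real.exp (c / 2 * t)) *
        ((∏ i, κ ^ min (s i) 0) * ∏ i, a i ^ min (s i) 0)) := by
        refine mul_le_mul_of_nonneg_left (hprod.trans ?_) (Real.exp_pos _).le
        have h1 : 0 ≤ ∏ i, a i ^ min (s i) 0 :=
          Finset.prod_nonneg fun i _ => Real.rpow_nonneg (ha' i) _
        gcongr
        exact hgrowth t ht
    _ = _ := by
        rw [show -(c / 2) * t = -c * t + c / 2 * t by ring, Real.exp_add]
        ring

theorem abs_add_le_mul_norm_add_mul {R : ℝ} (hR : 0 ≤ R) {w : ℂ} (hw : ‖1 - w‖ ≤ R * |w.im|)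
    (a b : ℝ) : |a + b| ≤ (1 + R) * ‖(a : ℂ) + w * b‖ := by
  set v : ℂ := a + w * b with hv
  have him : |w.im| * |b| ≤ ‖v‖ := by
    have : v.im = w.im * b := by simp [hv]
    rw [← abs_mul, ← this]
    exact Complex.abs_im_le_norm v
  calc |a + b| = ‖v + (1 - w) * b‖ := by
        rw [← Real.norm_eq_abs, ← Complex.norm_real]
        congr 1
        push_cast
        ring
    _ ≤ ‖v‖ + ‖1 - w‖ * |b| := by
        refine (norm_add_le _ _).trans_eq ?_
        rw [norm_mul, Complex.norm_real, Real.norm_eq_abs]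
    _ ≤ ‖v‖ + R * |w.im| * |b| := by gcongr
    _ ≤ ‖v‖ + R * ‖v‖ := by rw [mul_assoc]; gcongr
    _ = (1 + R) * ‖v‖ := by ring

theorem exists_mul_norm_le_of_posHomogeneous {E : Type*} [NormedAddCommGroup E] [NormedSpace ℝ E]
    [ProperSpace E] {g : E → ℝ} (hg : Continuous g) (hpos : ∀ v, v ≠ 0 → 0 < g v)
    (hhom : ∀ (t : ℝ) v, 0 ≤ t → g (t • v) = t * g v) : ∃ c, 0 < c ∧ ∀ v, c * ‖v‖ ≤ g v := by
  have hg0 : g 0 = 0 := by simpa using hhom 0 0 le_rfl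
  rcases subsingleton_or_nontrivial E with hE | hE
  · exact ⟨1, one_pos, fun v => by rw [Subsingleton.elim v 0, norm_zero, mul_zero, hg0]⟩
  obtain ⟨u, hu, humin⟩ := (isCompact_sphere (0 : E) 1).exists_isMinOn
    (NormedSpace.sphere_nonempty.2 zero_le_one) hg.continuousOn
  refine ⟨g u, hpos u (ne_zero_of_mem_unit_sphere ⟨u, hu⟩), fun v => ?_⟩
  rcases eq_or_ne v 0 with rfl | hv
  · rw [norm_zero, mul_zero, hg0]
  have hn : 0 < ‖v‖ := norm_pos_iff.2 hv
  have hmem : ‖v‖⁻¹ • v ∈ Metric.sphere (0 : E) 1 := by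
    rw [mem_sphere_zero_iff_norm, norm_smul, norm_inv, norm_norm, inv_mul_cancel₀ hn.ne']
  have hmin := isMinOn_iff.1 humin _ hmem
  rwa [hhom _ _ (inv_pos.2 hn).le, le_inv_mul_iff₀ hn, mul_comm] at hmin

theorem nonneg_of_bddBelow_ray {E : Type*} [AddCommGroup E] [Module ℝ E] {f : E →ₗ[ℝ] ℝ} {x v : E}
    {S : Set E} (hS : BddBelow (f '' S)) (hray : ∀ t : ℝ, 0 ≤ t → x + t • v ∈ S) : 0 ≤ f v := by
  obtain ⟨m, hm⟩ := hS
  by_contra! hneg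
  have htend : Tendsto (fun t : ℝ => f x + t * f v) atTop atBot :=
    tendsto_atBot_add_const_left _ _ (tendsto_id.atTop_mul_const_of_neg hneg)
  obtain ⟨t, htm, ht⟩ := ((htend.eventually_lt_atBot m).and (eventually_ge_atTop 0)).exists
  have h := hm (mem_image_of_mem f (hray t ht))
  rw [map_add, map_smul, smul_eq_mul] at h
  exact absurd h (not_le.2 htm)

theorem sign_mul_pos_iff {c : ℝ} (hc : c ≠ 0) (a : ℝ) :
    0 < (SignType.sign c : ℝ) * a ↔ 0 < c * a := by
  rw [← abs_mul_sign c, mul_assoc]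
  simp [hc]

/-! ### Half-planes -/

/-- The open half-plane `0 < τ * Im w`: the upper one for `0 < τ`, the lower one for `τ < 0`. -/
def halfPlane (τ : ℝ) : Set ℂ := {w | 0 < τ * w.im}

theorem im_ne_zero_of_mem_halfPlane {τ : ℝ} {w : ℂ} (hw : w ∈ halfPlane τ) : w.im ≠ 0 :=
  right_ne_zero_of_mul (ne_of_gt hw)

theorem isOpen_halfPlane (τ : ℝ) : IsOpen (halfPlane τ) :=
  isOpen_lt continuous_const (by fun_prop)

theorem convex_halfPlane (τ : ℝ) : Convex ℝ (halfPlane τ) :=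
  convex_halfSpace_gt (τ • Complex.imLm).isLinear 0

theorem tendsto_ofReal_add_mul_I_halfPlane {τ : ℝ} (hτ : τ ≠ 0) (t : ℝ) :
    Tendsto (fun s : ℝ => (t : ℂ) + (s * τ : ℝ) * Complex.I) (𝓝[>] 0) (𝓝[halfPlane τ] t) := by
  refine tendsto_nhdsWithin_iff.2 ⟨?_, ?_⟩
  · have hc : Continuous fun s : ℝ => (t : ℂ) + (s * τ : ℝ) * Complex.I := by fun_prop
    simpa using (hc.tendsto 0).mono_left nhdsWithin_le_nhds
  · filter_upwards [self_mem_nhdsWithin] with s hs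
    have : 0 < s * (τ * τ) := mul_pos hs (mul_self_pos.2 hτ)
    simpa [halfPlane, mul_left_comm τ s] using this

theorem ne_zero_of_eq_one_or {τ : ℝ} (hτ : τ = 1 ∨ τ = -1) : τ ≠ 0 := by
  rcases hτ with rfl | rfl <;> norm_num

theorem tendsto_one_add_mul_I_halfPlane {τ : ℝ} (hτ : τ ≠ 0) :
    Tendsto (fun s : ℝ => 1 + (s * τ : ℝ) * Complex.I) (𝓝[>] 0) (𝓝[halfPlane τ] 1) := by
  simpa only [Complex.ofReal_one] using tendsto_ofReal_add_mul_I_halfPlane hτ 1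

theorem ofReal_mem_closure_halfPlane {τ : ℝ} (hτ : τ ≠ 0) (t : ℝ) :
    (t : ℂ) ∈ closure (halfPlane τ) :=
  mem_closure_iff_nhdsWithin_neBot.2 (tendsto_ofReal_add_mul_I_halfPlane hτ t).neBot

/-- The unit complex numbers in `halfPlane τ`. -/
def arc (τ : ℝ) : Set ℂ := {ρ | ‖ρ‖ = 1 ∧ ρ ∈ halfPlane τ}

theorem exists_mem_arc_eq_ofReal_mul {τ : ℝ} {w : ℂ} (hw : w ∈ halfPlane τ) :
    ∃ r : ℝ, 0 < r ∧ ∃ ρ ∈ arc τ, w = r * ρ := by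
  have hw0 : w ≠ 0 := fun h => im_ne_zero_of_mem_halfPlane hw (by rw [h, Complex.zero_im])
  have hn : 0 < ‖w‖ := norm_pos_iff.2 hw0
  refine ⟨‖w‖, hn, ((‖w‖⁻¹ : ℝ) : ℂ) * w, ⟨?_, ?_⟩, ?_⟩
  · rw [norm_mul, Complex.norm_real, norm_inv, norm_norm, inv_mul_cancel₀ hn.ne']
  · change 0 < τ * _
    rw [Complex.im_ofReal_mul, mul_left_comm]
    exact mul_pos (inv_pos.2 hn) hw
  · rw [← mul_assoc, ← Complex.ofReal_mul, mul_inv_cancel₀ hn.ne', Complex.ofReal_one, one_mul]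

theorem isPreconnected_halfPlane_union_ofReal_image {τ : ℝ} (hτ : τ ≠ 0) (s : Set ℝ) :
    IsPreconnected (halfPlane τ ∪ Complex.ofReal '' s) :=
  (convex_halfPlane τ).isPreconnected.subset_closure subset_union_left <|
    union_subset subset_closure <| image_subset_iff.2 fun t _ => ofReal_mem_closure_halfPlane hτ t

theorem eqOn_halfPlane_of_eq_on_Ioo {τ a b : ℝ} (hτ : τ ≠ 0) (hab : a < b) {g h : ℂ → ℂ}
    (hg : AnalyticOnNhd ℂ g (halfPlane τ ∪ Complex.ofReal '' Ioo a b))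
    (hh : AnalyticOnNhd ℂ h (halfPlane τ ∪ Complex.ofReal '' Ioo a b))
    (hgh : ∀ t ∈ Ioo a b, g t = h t) : EqOn g h (halfPlane τ) := by
  obtain ⟨c, hc⟩ := nonempty_Ioo.2 hab
  have htend : Tendsto Complex.ofReal (𝓝[≠] c) (𝓝[≠] (c : ℂ)) :=
    tendsto_nhdsWithin_iff.2 ⟨Complex.continuous_ofReal.continuousAt.mono_left nhdsWithin_le_nhds,
      eventually_mem_nhdsWithin.mono fun t ht => Complex.ofReal_injective.ne ht⟩
  have hnear : ∀ᶠ t : ℝ in 𝓝[≠] c, g t = h t :=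
    eventually_of_mem (mem_nhdsWithin_of_mem_nhds (Ioo_mem_nhds hc.1 hc.2)) hgh
  exact (hg.eqOn_of_preconnected_of_frequently_eq hh
    (isPreconnected_halfPlane_union_ofReal_image hτ _) (Or.inr (mem_image_of_mem _ hc))
    (htend.frequently hnear.frequently)).mono subset_union_left

/-! ### Holomorphic families of integrals -/

section Holomorphic

variable {E : Type*} [NormedAddCommGroup E] [NormedSpace ℂ E]

theorem differentiableAt_integral_of_dominated {α : Type*} [MeasurableSpace α] {μ : Measure α}
    {F : ℂ → α → E} {bound : α → ℝ} {U : Set ℂ} {w₀ : ℂ} (hU : U ∈ 𝓝 w₀)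
    (hF_meas : ∀ w, AEStronglyMeasurable (F w) μ)
    (hF_diff : ∀ᵐ x ∂μ, DifferentiableOn ℂ (fun w => F w x) U)
    (h_bound : ∀ᵐ x ∂μ, ∀ w ∈ U, ‖F w x‖ ≤ bound x) (bound_integrable : Integrable bound μ) :
    DifferentiableAt ℂ (fun w => ∫ x, F w x ∂μ) w₀ := by
  obtain ⟨r, hr, hball⟩ := Metric.mem_nhds_iff.1 hU
  have hnhds : ∀ w ∈ Metric.ball w₀ r, U ∈ 𝓝 w := fun w hw =>
    mem_of_superset (Metric.isOpen_ball.mem_nhds hw) hball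
  have hsub : ∀ w ∈ Metric.ball w₀ (r / 2), Metric.closedBall w (r / 2) ⊆ Metric.ball w₀ r :=
    fun w hw => Metric.closedBall_subset_ball' (by linarith [Metric.mem_ball.1 hw])
  refine (hasDerivAt_integral_of_dominated_loc_of_deriv_le (𝕜 := ℂ)
    (F' := fun w x => deriv (fun w => F w x) w) (bound := fun x => bound x / (r / 2))
    (Metric.ball_mem_nhds w₀ (half_pos hr)) (Eventually.of_forall hF_meas)
    (bound_integrable.mono' (hF_meas w₀) (h_bound.mono fun x hx => hx w₀ (mem_of_mem_nhds hU)))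
    ?_ ?_ (bound_integrable.div_const _) ?_).2.differentiableAt
  · refine aestronglyMeasurable_of_tendsto_ae (𝓝[≠] w₀)
      (f := fun w x => slope (fun w => F w x) w₀ w)
      (fun w => ((hF_meas w).sub (hF_meas w₀)).const_smul (w - w₀)⁻¹) ?_
    filter_upwards [hF_diff] with x hx
    exact hasDerivAt_iff_tendsto_slope.1 (hx.differentiableAt hU).hasDerivAt
  · filter_upwards [hF_diff, h_bound] with x hx hxb w hw
    refine Complex.norm_deriv_le_of_forall_mem_sphere_norm_le (half_pos hr) ?_ fun z hz =>
      hxb z (hball (hsub w hw (Metric.sphere_subset_closedBall hz)))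
    exact (hx.mono ((hsub w hw).trans hball)).diffContOnCl_ball subset_rfl
  · filter_upwards [hF_diff] with x hx w hw
    exact (hx.differentiableAt
      (hnhds w (Metric.ball_subset_ball (by linarith) hw))).hasDerivAt

theorem eq_of_differentiableOn_of_ofReal_mul_eq {f : ℂ → E} {U : Set ℂ} (hU : IsOpen U)
    (hU' : IsPreconnected U) (h0 : (0 : ℂ) ∉ U) (hf : DifferentiableOn ℂ f U)
    (hscale : ∀ w ∈ U, ∀ r : ℝ, 0 < r → f (r * w) = f w) {w w' : ℂ} (hw : w ∈ U) (hw' : w' ∈ U) :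
    f w = f w' := by
  refine hU.is_const_of_deriv_eq_zero hU' hf (fun u hu => ?_) hw hw'
  have hmul : HasDerivAt (fun r : ℝ => (r : ℂ) * u) u 1 := by
    simpa using (hasDerivAt_id (1 : ℝ)).ofReal_comp.mul_const u
  have hderiv : HasDerivAt (fun r : ℝ => f (r * u)) (u • deriv f u) 1 := by
    refine HasDerivAt.scomp (1 : ℝ) (h := fun r : ℝ => (r : ℂ) * u) ?_ hmul
    simpa using (hf.differentiableAt (hU.mem_nhds hu)).hasDerivAt
  have hconst : HasDerivAt (fun r : ℝ => f (r * u)) 0 1 :=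
    (hasDerivAt_const (1 : ℝ) (f u)).congr_of_eventuallyEq
      ((lt_mem_nhds one_pos).mono fun r hr => hscale u hu r hr)
  exact (smul_eq_zero.1 (hderiv.unique hconst)).resolve_left (ne_of_mem_of_not_mem hu h0)

end Holomorphic

theorem setIntegral_comp_homothety {E F : Type*} [NormedAddCommGroup E] [NormedSpace ℝ E]
    [MeasurableSpace E] [BorelSpace E] [FiniteDimensional ℝ E] [NormedAddCommGroup F]
    [NormedSpace ℝ F] (μ : Measure E) [μ.IsAddHaarMeasure] (g : E → F) {S : Set E}
    (hS : MeasurableSet S) {p : E} {r : ℝ} (hr : 0 < r)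
    (hSr : ∀ x, p + r • (x - p) ∈ S ↔ x ∈ S) :
    r ^ Module.finrank ℝ E • ∫ x in S, g (p + r • (x - p)) ∂μ = ∫ x in S, g x ∂μ := by
  have hind : S.indicator (fun x => g (p + r • (x - p))) =
      fun x => S.indicator g (p + r • (x - p)) := by
    ext x
    by_cases hx : x ∈ S
    · rw [indicator_of_mem hx, indicator_of_mem ((hSr x).2 hx)]
    · rw [indicator_of_notMem hx, indicator_of_notMem (mt (hSr x).1 hx)]
  rw [← integral_indicator hS, ← integral_indicator hS, hind,
    integral_sub_right_eq_self (fun x => S.indicator g (p + r • x)) p,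
    Measure.integral_comp_smul μ (fun x => S.indicator g (p + x)) r,
    integral_add_left_eq_self (S.indicator g) p, abs_of_pos (by positivity), smul_smul,
    mul_inv_cancel₀ (by positivity), one_smul]

/-! ### Branches of complex powers -/

theorem ofReal_add_mul_ofReal_mem_slitPlane {w : ℂ} (hw : w.im ≠ 0) {a b : ℝ}
    (h : b = 0 → 0 < a) : (a : ℂ) + w * b ∈ Complex.slitPlane := by
  rw [Complex.mem_slitPlane_iff]
  rcases eq_or_ne b 0 with rfl | hb
  · exact Or.inl (by simpa using h rfl)
  · exact Or.inr (by simpa using ⟨hw, hb⟩)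

theorem cpow_eq_neg_cpow_mul_exp {τ : ℝ} (hτ : τ = 1 ∨ τ = -1) {z : ℂ} (hz : τ * z.im < 0)
    (a : ℂ) : z ^ a = (-z) ^ a * Complex.exp (-τ * (Real.pi * Complex.I) * a) := by
  have hz0 : z ≠ 0 := by
    rintro rfl
    simp at hz
  have hlog : Complex.log z = Complex.log (-z) + -τ * (Real.pi * Complex.I) := by
    simp only [Complex.log, norm_neg]
    rcases hτ with rfl | rfl
    · rw [Complex.arg_neg_eq_arg_add_pi_of_im_neg (by linarith)]
      push_cast
      ring
    · rw [Complex.arg_neg_eq_arg_sub_pi_of_im_pos (by linarith)]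
      push_cast
      ring
  rw [Complex.cpow_def_of_ne_zero hz0, Complex.cpow_def_of_ne_zero (neg_ne_zero.2 hz0), hlog,
    ← Complex.exp_add, add_mul]

namespace Arrangement

variable {k N : ℕ} (A : Arrangement k N)

/-! ### Majorants of the integrands -/

theorem f_eq_l_sub (X : A.Vertex) {j : Fin N} (hj : j ∈ X.1) (x : Fin k → ℝ) :
    A.f j x = A.l j (x - A.pt X) := by
  have h := A.f_add j (A.pt X) (x - A.pt X)
  rwa [add_sub_cancel, A.f_pt X hj, zero_add] at h

/-- The linear coordinates `(l_j)_{j ∈ X}` on `ℝ^k`, with the elements of `X` listed in increasing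
order. -/
def coordMap (X : A.Vertex) : (Fin k → ℝ) →ₗ[ℝ] (Fin k → ℝ) :=
  LinearMap.pi fun i => A.l (X.1.orderEmbOfFin X.2 i)

theorem coordMap_injective (X : A.Vertex) : Function.Injective (A.coordMap X) := by
  rw [injective_iff_map_eq_zero]
  intro v hv
  refine A.eq_zero_of_l X v fun j hj => ?_
  obtain ⟨i, rfl⟩ : j ∈ Set.range (X.1.orderEmbOfFin X.2) := by
    rwa [Finset.range_orderEmbOfFin]
  exact congrFun hv i

theorem prod_vertex {M : Type*} [CommMonoid M] (X : A.Vertex) (g : Fin N → M) :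
    ∏ j ∈ X.1, g j = ∏ i : Fin k, g (X.1.orderEmbOfFin X.2 i) := by
  rw [← Finset.prod_coe_sort]
  exact (Fintype.prod_equiv (X.1.orderIsoOfFin X.2).toEquiv _ _ fun i => rfl).symm

/-- An integrable majorant, up to constants, of the integrands attached to the vertex `X`. Only the
hyperplanes through `X` can contribute negative exponents. -/
def dom (c : ℝ) (X : A.Vertex) (x : Fin k → ℝ) : ℝ :=
  Real.exp (-c * ‖x‖) * ∏ j ∈ X.1, |A.f j x| ^ min (A.α j - 1) 0

theorem integrable_dom {c : ℝ} (hc : 0 < c) (X : A.Vertex) : Integrable (A.dom c X) := by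
  have h := integrable_exp_neg_mul_norm_mul_prod_abs_linearMap_rpow
    (s := fun i => min (A.α (X.1.orderEmbOfFin X.2 i) - 1) 0)
    (fun i => lt_min (by linarith [A.α_pos (X.1.orderEmbOfFin X.2 i)]) (by norm_num)) hc
    (A.coordMap_injective X) (A.pt X)
  refine h.congr (Eventually.of_forall fun x => ?_)
  simp only [dom, A.prod_vertex X, A.f_eq_l_sub X (Finset.orderEmbOfFin_mem _ _ _)]
  rfl

/-- The absolute value of `(∏ f_j^{α_j}) (∏_{j ∈ X} f_j)⁻¹` in terms of the absolute values `z_j`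
of the `f_j`. -/
def modulus (X : A.Vertex) (z : Fin N → ℝ) : ℝ :=
  (∏ j, z j ^ A.α j) * (∏ j ∈ X.1, z j)⁻¹

theorem modulus_nonneg (X : A.Vertex) {z : Fin N → ℝ} (hz : ∀ j, 0 ≤ z j) :
    0 ≤ A.modulus X z :=
  mul_nonneg (Finset.prod_nonneg fun j _ => Real.rpow_nonneg (hz j) _)
    (inv_nonneg.2 (Finset.prod_nonneg fun j _ => hz j))

theorem modulus_eq_prod_rpow (X : A.Vertex) {z : Fin N → ℝ} (hz : ∀ j, 0 < z j) :
    A.modulus X z = ∏ j, z j ^ (if j ∈ X.1 then A.α j - 1 else A.α j) := by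
  have hX : ∏ j ∈ X.1, z j = ∏ j, if j ∈ X.1 then z j else 1 := by
    rw [Finset.prod_ite_mem, Finset.univ_inter]
  rw [modulus, hX, ← Finset.prod_inv_distrib, ← Finset.prod_mul_distrib]
  refine Finset.prod_congr rfl fun j _ => ?_
  split_ifs
  · rw [Real.rpow_sub_one (hz j).ne', div_eq_mul_inv]
  · rw [inv_one, mul_one]

theorem exists_exp_mul_modulus_le_dom (X : A.Vertex) {κ M c : ℝ} (hκ : 0 < κ) (hM : 0 ≤ M)
    (hc : 0 < c) :
    ∃ C, 0 ≤ C ∧ ∀ (x : Fin k → ℝ) (z : Fin N → ℝ), x ∈ A.compl →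
      (∀ j, κ * |A.f j x| ≤ z j) → (∀ j, z j ≤ M * (1 + ‖x‖)) →
      Real.exp (-c * ‖x‖) * A.modulus X z ≤ C * A.dom (c / 2) X x := by
  obtain ⟨C, hC, h⟩ := exists_exp_mul_prod_rpow_le
    (fun j : Fin N => if j ∈ X.1 then A.α j - 1 else A.α j) hκ hM hc
  refine ⟨C, hC, fun x z hx hlow hup => ?_⟩
  have hf : ∀ j, 0 < |A.f j x| := fun j => abs_pos.2 (hx j)
  have hdom : ∏ j, |A.f j x| ^ min (if j ∈ X.1 then A.α j - 1 else A.α j) 0 =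
      ∏ j ∈ X.1, |A.f j x| ^ min (A.α j - 1) 0 := by
    rw [← Finset.univ_inter X.1, ← Finset.prod_ite_mem, Finset.univ_inter]
    refine Finset.prod_congr rfl fun j _ => ?_
    split_ifs
    · rfl
    · rw [min_eq_right (A.α_pos j).le, Real.rpow_zero]
  rw [A.modulus_eq_prod_rpow X fun j => (mul_pos hκ (hf j)).trans_le (hlow j), dom, ← hdom]
  exact h ‖x‖ (fun j => |A.f j x|) z (norm_nonneg x) hf hlow hup

theorem norm_Ω (X : A.Vertex) (x : Fin k → ℝ) :
    ‖(A.Ω X x : ℂ)‖ = A.vol X * A.modulus X fun j => |A.f j x| := by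
  have hvol : |A.vol X| = A.vol X := abs_of_nonneg (abs_nonneg _)
  simp only [Complex.norm_real, Real.norm_eq_abs, Ω, modulus, abs_mul, abs_div, Finset.abs_prod,
    hvol, Real.abs_rpow_of_nonneg (abs_nonneg _), abs_abs]
  ring

theorem exists_abs_f_le : ∃ M, 0 ≤ M ∧ ∀ j x, |A.f j x| ≤ M * (1 + ‖x‖) := by
  set L := fun j => LinearMap.toContinuousLinearMap (A.l j)
  have hj : ∀ j, 0 ≤ |A.f j 0| + ‖L j‖ := fun j => by positivity
  refine ⟨∑ j, (|A.f j 0| + ‖L j‖), Finset.sum_nonneg fun j _ => hj j, fun j x => ?_⟩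
  calc |A.f j x| = |A.f j 0 + A.l j x| := by rw [← A.f_add, zero_add]
    _ ≤ |A.f j 0| + ‖L j‖ * ‖x‖ := (abs_add_le _ _).trans (by gcongr; exact (L j).le_opNorm x)
    _ ≤ (|A.f j 0| + ‖L j‖) * (1 + ‖x‖) := by
      nlinarith [abs_nonneg (A.f j 0), norm_nonneg (L j), norm_nonneg x]
    _ ≤ (∑ j, (|A.f j 0| + ‖L j‖)) * (1 + ‖x‖) := by
      gcongr
      exact Finset.single_le_sum (f := fun j => |A.f j 0| + ‖L j‖) (fun i _ => hj i)
        (Finset.mem_univ j)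

/-! ### Integrals over domains -/

theorem mem_component_iff {x y : Fin k → ℝ} (hx : x ∈ A.compl) :
    y ∈ connectedComponentIn A.compl x ↔ ∀ j, 0 < A.f j x * A.f j y := by
  refine ⟨A.sign_of_mem hx, fun h => ?_⟩
  rw [A.component_eq h]
  exact mem_connectedComponentIn fun j hj => (h j).ne' (by rw [hj, mul_zero])

theorem isOpen_compl : IsOpen A.compl := by
  have h : A.compl = ⋂ j, A.f j ⁻¹' {0}ᶜ := by
    ext x
    simp [compl]
  rw [h]
  exact isOpen_iInter_of_finite fun j => isOpen_compl_singleton.preimage (A.f_continuous j)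

theorem isOpen_of_mem_domains {Δ : Set (Fin k → ℝ)} (hΔ : Δ ∈ A.domains) : IsOpen Δ := by
  obtain ⟨x, -, rfl⟩ := hΔ
  exact A.isOpen_compl.connectedComponentIn

theorem subset_compl_of_mem_domains {Δ : Set (Fin k → ℝ)} (hΔ : Δ ∈ A.domains) :
    Δ ⊆ A.compl := by
  obtain ⟨x, -, rfl⟩ := hΔ
  exact connectedComponentIn_subset _ _

section Recession

variable {x v : Fin k → ℝ}

theorem f₀_nonneg_of_recession (hx : x ∈ A.compl)
    (hb : BddBelow (A.f₀ '' connectedComponentIn A.compl x)) (hv : ∀ j, 0 ≤ A.f j x * A.l j v) :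
    0 ≤ A.f₀ v := by
  refine nonneg_of_bddBelow_ray hb (x := x) fun t ht => ?_
  rw [A.mem_component_iff hx]
  intro j
  rw [A.f_add, map_smul, smul_eq_mul]
  nlinarith [mul_self_pos.2 (hx j), mul_nonneg ht (hv j)]

theorem exists_edge_direction (hv : v ≠ 0) :
    ∃ e, A.f₀ e = 1 ∧ ∀ j, A.l j v = 0 → A.l j e = 0 := by
  classical
  set J : Finset (Fin N) := Finset.univ.filter fun j => A.l j v = 0 with hJ
  have hJk : J.card < k := by
    by_contra! hk
    obtain ⟨Y, hYJ, hY⟩ := Finset.exists_subset_card_eq hk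
    exact hv (A.eq_zero_of_l ⟨Y, hY⟩ v fun j hj => (Finset.mem_filter.1 (hYJ hj)).2)
  obtain ⟨U, hJU, hU⟩ := Finset.exists_superset_card_eq (s := J) (n := k - 1) (by omega) (by
    rw [Fintype.card_fin]
    have := A.k_le
    omega)
  obtain ⟨e, ⟨he, he1⟩, -⟩ := A.existsUnique_edgeVec U (by omega)
  exact ⟨e, he1, fun j hj => he j (hJU (by simp [hJ, hj]))⟩

/- Subtracting a small multiple of an edge direction `e` with `f₀ e = 1` keeps `v` in the recession
cone, so `f₀ v` is bounded below by that multiple. -/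
theorem f₀_pos_of_recession (hx : x ∈ A.compl)
    (hb : BddBelow (A.f₀ '' connectedComponentIn A.compl x)) (hv : v ≠ 0)
    (hv' : ∀ j, 0 ≤ A.f j x * A.l j v) : 0 < A.f₀ v := by
  obtain ⟨e, he, hle⟩ := A.exists_edge_direction hv
  have hnear : ∀ᶠ ε : ℝ in 𝓝[>] 0, ∀ j, 0 ≤ A.f j x * A.l j (v - ε • e) := by
    rw [eventually_all]
    intro j
    by_cases hj : A.l j v = 0
    · refine Eventually.of_forall fun ε => ?_
      rw [map_sub, map_smul, hj, hle j hj, smul_zero, sub_zero, mul_zero]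
    · have hpos : 0 < A.f j x * A.l j v := (hv' j).lt_of_ne (mul_ne_zero (hx j) hj).symm
      have hlim : Tendsto (fun ε : ℝ => A.f j x * (A.l j v - ε * A.l j e)) (𝓝[>] 0)
          (𝓝 (A.f j x * (A.l j v - 0 * A.l j e))) :=
        (Continuous.tendsto (by fun_prop) 0).mono_left nhdsWithin_le_nhds
      rw [zero_mul, sub_zero] at hlim
      refine (hlim.eventually_const_lt hpos).mono fun ε hε => ?_
      rw [map_sub, map_smul, smul_eq_mul]
      exact hε.le
  obtain ⟨ε, hε, hε0⟩ := (hnear.and self_mem_nhdsWithin).exists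
  have h := A.f₀_nonneg_of_recession hx hb hε
  rw [map_sub, map_smul, he, smul_eq_mul, mul_one] at h
  exact (mem_Ioi.1 hε0).trans_le (sub_nonneg.1 h)

end Recession

theorem exists_mul_norm_le_f₀_add_sum {x : Fin k → ℝ} (hx : x ∈ A.compl)
    (hb : BddBelow (A.f₀ '' connectedComponentIn A.compl x)) :
    ∃ c, 0 < c ∧ ∀ v,
      c * ‖v‖ ≤ max (A.f₀ v) 0 + ∑ j, max (-(A.f j x * A.l j v)) 0 := by
  have hl : ∀ j, Continuous (A.l j) := fun j => (A.l j).continuous_of_finiteDimensional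
  have hf₀ : Continuous A.f₀ := A.f₀.continuous_of_finiteDimensional
  refine exists_mul_norm_le_of_posHomogeneous (by fun_prop) (fun v hv => ?_) fun t v ht => ?_
  · by_cases h : ∀ j, 0 ≤ A.f j x * A.l j v
    · exact add_pos_of_pos_of_nonneg (lt_max_of_lt_left (A.f₀_pos_of_recession hx hb hv h))
        (Finset.sum_nonneg fun _ _ => le_max_right _ _)
    · push Not at h
      obtain ⟨j, hj⟩ := h
      exact add_pos_of_nonneg_of_pos (le_max_right _ _) (Finset.sum_pos'
        (fun _ _ => le_max_right _ _) ⟨j, Finset.mem_univ j, lt_max_of_lt_left (neg_pos.2 hj)⟩)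
  · simp only [map_smul, smul_eq_mul, mul_add, Finset.mul_sum, mul_max_of_nonneg _ _ ht,
      mul_zero, mul_neg, mul_left_comm t]

theorem exists_f₀_lower_bound {Δ : Set (Fin k → ℝ)} (hΔ : Δ ∈ A.domainsPlus) :
    ∃ c C : ℝ, 0 < c ∧ ∀ x ∈ Δ, c * ‖x‖ - C ≤ A.f₀ x := by
  obtain ⟨⟨x₀, hx₀, rfl⟩, hb⟩ := hΔ
  obtain ⟨c, hc, hcv⟩ := A.exists_mul_norm_le_f₀_add_sum hx₀ hb
  obtain ⟨m, hm⟩ := hb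
  refine ⟨c, |m| + ∑ j, |A.f j x₀ * A.f j 0|, hc, fun x hx => ?_⟩
  have hf₀ : max (A.f₀ x) 0 ≤ A.f₀ x + |m| := by
    have := hm (mem_image_of_mem _ hx)
    exact max_le (by linarith [abs_nonneg m]) (by linarith [neg_abs_le m])
  have hl : ∑ j, max (-(A.f j x₀ * A.l j x)) 0 ≤ ∑ j, |A.f j x₀ * A.f j 0| := by
    refine Finset.sum_le_sum fun j _ => max_le ?_ (abs_nonneg _)
    have hsign := A.sign_of_mem hx₀ hx j
    rw [← zero_add x, A.f_add, mul_add] at hsign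
    linarith [le_abs_self (A.f j x₀ * A.f j 0)]
  linarith [hcv x]

theorem f_measurable (j : Fin N) : Measurable (A.f j) := (A.f_continuous j).measurable

theorem integrand_measurable (X : A.Vertex) (lam : ℂ) : Measurable (A.integrand X lam) := by
  have hf := A.f_measurable
  have hf₀ : Measurable A.f₀ := A.f₀.continuous_of_finiteDimensional.measurable
  have hΩ : Measurable (A.Ω X) := by
    unfold Ω
    fun_prop
  unfold integrand
  fun_prop

theorem integrableOn_integrand {Δ : Set (Fin k → ℝ)} (hΔ : Δ ∈ A.domainsPlus) (X : A.Vertex)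
    {lam : ℂ} (hlam : 0 < lam.re) : IntegrableOn (A.integrand X lam) Δ := by
  obtain ⟨c, C, hc, hf₀⟩ := A.exists_f₀_lower_bound hΔ
  obtain ⟨M, hM, hf⟩ := A.exists_abs_f_le
  obtain ⟨D, -, hD⟩ := A.exists_exp_mul_modulus_le_dom X one_pos hM (mul_pos hlam hc)
  have hvol : 0 ≤ A.vol X := abs_nonneg _
  refine ((A.integrable_dom (half_pos (mul_pos hlam hc)) X).const_mul
    (A.vol X * Real.exp (lam.re * C) * D)).integrableOn.mono'
    (A.integrand_measurable X lam).aestronglyMeasurable ?_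
  refine (ae_restrict_iff' (A.isOpen_of_mem_domains hΔ.1).measurableSet).2
    (Eventually.of_forall fun x hx => ?_)
  set Q := A.modulus X fun j => |A.f j x|
  have hQ : 0 ≤ Q := A.modulus_nonneg X fun j => abs_nonneg _
  have hexp : ‖Complex.exp (-lam * (A.f₀ x : ℂ))‖ ≤
      Real.exp (lam.re * C) * Real.exp (-(lam.re * c) * ‖x‖) := by
    rw [← Real.exp_add, Complex.norm_exp, Complex.re_mul_ofReal, Complex.neg_re]
    refine Real.exp_le_exp.2 ?_
    nlinarith [mul_le_mul_of_nonneg_left (hf₀ x hx) hlam.le]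
  calc ‖A.integrand X lam x‖
      ≤ Real.exp (lam.re * C) * Real.exp (-(lam.re * c) * ‖x‖) * (A.vol X * Q) := by
        rw [integrand, norm_mul, A.norm_Ω]
        gcongr
    _ = A.vol X * Real.exp (lam.re * C) * (Real.exp (-(lam.re * c) * ‖x‖) * Q) := by ring
    _ ≤ A.vol X * Real.exp (lam.re * C) * (D * A.dom (lam.re * c / 2) X x) := by
        refine mul_le_mul_of_nonneg_left ?_ (mul_nonneg hvol (Real.exp_pos _).le)
        exact hD x _ (A.subset_compl_of_mem_domains hΔ.1 hx) (fun j => (one_mul _).le)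
          fun j => hf j x
    _ = A.vol X * Real.exp (lam.re * C) * D * A.dom (lam.re * c / 2) X x := by ring

/-! ### Signs on the base domain and the real cone -/

theorem exists_base_point (X : A.Vertex) : ∃ p ∈ A.baseDomain X,
    p ∈ A.cone X ∧ p ∈ A.compl ∧ ∀ i, i ∉ X.1 → 0 < A.f i p * A.f i (A.pt X) := by
  obtain ⟨a, ha, hs, hp, hbase, -⟩ := A.baseDomain_aux X
  refine ⟨_, ?_, ⟨a, ha, rfl⟩, hp, hs⟩
  rw [(A.existsUnique_baseDomain X).unique (A.baseDomain_spec X) hbase]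
  exact mem_connectedComponentIn hp

/-- A point of `Δ_X` where the signs of the `f_j` are read off. -/
def basePoint (X : A.Vertex) : Fin k → ℝ := (A.exists_base_point X).choose

/-- The sign of `f_j` on `Δ_X`, as a real number. -/
def sgn (X : A.Vertex) (j : Fin N) : ℝ := SignType.sign (A.f j (A.basePoint X))

theorem basePoint_mem_baseDomain (X : A.Vertex) : A.basePoint X ∈ A.baseDomain X :=
  (A.exists_base_point X).choose_spec.1

theorem basePoint_mem_cone (X : A.Vertex) : A.basePoint X ∈ A.cone X :=
  (A.exists_base_point X).choose_spec.2.1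

theorem f_basePoint_ne (X : A.Vertex) (j : Fin N) : A.f j (A.basePoint X) ≠ 0 :=
  (A.exists_base_point X).choose_spec.2.2.1 j

theorem f_basePoint_mul_f_pt_pos (X : A.Vertex) {i : Fin N} (hi : i ∉ X.1) :
    0 < A.f i (A.basePoint X) * A.f i (A.pt X) :=
  (A.exists_base_point X).choose_spec.2.2.2 i hi

theorem sgn_eq_one_or (X : A.Vertex) (j : Fin N) : A.sgn X j = 1 ∨ A.sgn X j = -1 := by
  unfold sgn
  rcases (A.f_basePoint_ne X j).lt_or_gt with h | h
  · simp [h]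
  · simp [h]

theorem sgn_ne_zero (X : A.Vertex) (j : Fin N) : A.sgn X j ≠ 0 := by
  rcases A.sgn_eq_one_or X j with h | h <;> simp [h]

theorem abs_sgn (X : A.Vertex) (j : Fin N) : |A.sgn X j| = 1 := by
  rcases A.sgn_eq_one_or X j with h | h <;> simp [h]

theorem sgn_mul_pos_iff (X : A.Vertex) (j : Fin N) (b : ℝ) :
    0 < A.sgn X j * b ↔ 0 < A.f j (A.basePoint X) * b :=
  sign_mul_pos_iff (A.f_basePoint_ne X j) b

theorem mem_baseDomain_iff (X : A.Vertex) (x : Fin k → ℝ) :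
    x ∈ A.baseDomain X ↔ ∀ j, 0 < A.sgn X j * A.f j x := by
  obtain ⟨p, -, hp⟩ := (A.baseDomain_spec X).1
  have h := A.basePoint_mem_baseDomain X
  simp only [sgn_mul_pos_iff]
  rw [hp] at h ⊢
  rw [connectedComponentIn_eq h, A.mem_component_iff (A.f_basePoint_ne X)]

theorem mem_cone_iff (X : A.Vertex) (x : Fin k → ℝ) :
    x ∈ A.cone X ↔ ∀ j ∈ X.1, 0 < A.sgn X j * A.f j x := by
  obtain ⟨a, ha, hp⟩ := A.basePoint_mem_cone X
  obtain ⟨b, rfl⟩ := A.exists_coord X x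
  have hsign : ∀ (b : {j // j ∈ X.1} → ℝ) (j : {j // j ∈ X.1}),
      0 < A.sgn X j * A.f j (A.pt X + ∑ i, b i • A.e X i) ↔ 0 < b j := by
    intro b j
    rw [sgn_mul_pos_iff, hp, A.f_eq_l_sub X j.2, A.f_eq_l_sub X j.2, add_sub_cancel_left,
      add_sub_cancel_left, A.l_sum, A.l_sum, mul_mul_mul_comm,
      mul_pos_iff_of_pos_right (mul_self_pos.2 (A.l_e_ne X j)), mul_pos_iff_of_pos_left (ha j)]
  constructor
  · rintro ⟨c, hc, hx⟩ j hj
    rw [hx]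
    exact (hsign c ⟨j, hj⟩).2 (hc ⟨j, hj⟩)
  · exact fun h => ⟨b, fun j => (hsign b j).1 (h j j.2), rfl⟩

theorem sgn_mul_f_pt_pos (X : A.Vertex) {j : Fin N} (hj : j ∉ X.1) :
    0 < A.sgn X j * A.f j (A.pt X) :=
  (A.sgn_mul_pos_iff X j _).2 (A.f_basePoint_mul_f_pt_pos X hj)

theorem f_pt_add_smul (X : A.Vertex) (j : Fin N) (t : ℝ) (x : Fin k → ℝ) :
    A.f j (A.pt X + t • (x - A.pt X)) = A.f j (A.pt X) + t * A.l j (x - A.pt X) := by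
  rw [A.f_add, map_smul, smul_eq_mul]

theorem homothety_mem_cone_iff (X : A.Vertex) {t : ℝ} (ht : 0 < t) (x : Fin k → ℝ) :
    A.pt X + t • (x - A.pt X) ∈ A.cone X ↔ x ∈ A.cone X := by
  rw [mem_cone_iff, mem_cone_iff]
  refine forall₂_congr fun j hj => ?_
  rw [f_pt_add_smul, A.f_pt X hj, zero_add, ← A.f_eq_l_sub X hj, mul_left_comm,
    mul_pos_iff_of_pos_left ht]

theorem isOpen_cone (X : A.Vertex) : IsOpen (A.cone X) := by
  have h : A.cone X = ⋂ j : {j // j ∈ X.1}, {x | 0 < A.sgn X j * A.f j x} := by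
    ext x
    simp [A.mem_cone_iff X x]
  rw [h]
  exact isOpen_iInter_of_finite fun j =>
    isOpen_lt continuous_const (continuous_const.mul (A.f_continuous j))

theorem exists_mul_norm_le_f₀_of_mem_cone (X : A.Vertex) :
    ∃ c, 0 < c ∧ ∀ x ∈ A.cone X, c * ‖x - A.pt X‖ ≤ A.f₀ (x - A.pt X) := by
  set S := 1 + ∑ j, ‖A.e X j‖ with hS
  have hS0 : 0 < S := by positivity
  refine ⟨S⁻¹, inv_pos.2 hS0, ?_⟩
  rintro x ⟨a, ha, rfl⟩
  rw [add_sub_cancel_left, A.f₀_sum, inv_mul_le_iff₀ hS0, Finset.mul_sum]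
  refine (norm_sum_le _ _).trans (Finset.sum_le_sum fun j _ => ?_)
  rw [norm_smul, Real.norm_of_nonneg (ha j).le, mul_comm]
  have hj : ‖A.e X j‖ ≤ ∑ i, ‖A.e X i‖ :=
    Finset.single_le_sum (f := fun i => ‖A.e X i‖) (fun _ _ => norm_nonneg _) (Finset.mem_univ j)
  exact mul_le_mul_of_nonneg_right (by linarith [hS]) (ha j).le

theorem ae_f_ne_zero (j : Fin N) : ∀ᵐ x : Fin k → ℝ, A.f j x ≠ 0 := by
  let H : AffineSubspace ℝ (Fin k → ℝ) := (affineSpan ℝ {(0 : ℝ)}).comap (A.f j)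
  have hH : (H : Set (Fin k → ℝ)) = {x | A.f j x = 0} := by
    ext x
    simp [H]
  have hne : H ≠ ⊤ := by
    intro htop
    have hzero : ∀ x, A.f j x = 0 := fun x => by
      have hx : x ∈ (H : Set (Fin k → ℝ)) := by rw [htop]; trivial
      rwa [hH] at hx
    refine A.nonconst j (LinearMap.ext fun v => ?_)
    have h := A.f_add j 0 v
    rw [hzero, hzero, zero_add] at h
    exact h.symm
  have h := Measure.addHaar_affineSubspace volume H hne
  rw [hH] at h
  exact measure_eq_zero_iff_ae_notMem.1 h

theorem ae_mem_compl : ∀ᵐ x : Fin k → ℝ, x ∈ A.compl := ae_all_iff.2 A.ae_f_ne_zero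

/-! ### The determination of `Ω` -/

theorem fC_F (X : A.Vertex) (w : ℂ) (x : Fin k → ℝ) (j : Fin N) :
    A.fC j (A.F X w x) = (A.f j (A.pt X) : ℂ) + w * (A.l j (x - A.pt X) : ℂ) :=
  A.fC_toC_add j _ _ _

theorem f₀C_F (X : A.Vertex) (w : ℂ) (x : Fin k → ℝ) :
    A.f₀C (A.F X w x) = (A.f₀ (A.pt X) : ℂ) + w * (A.f₀ (x - A.pt X) : ℂ) := by
  have hf₀ : ∀ v : Fin k → ℝ, (A.f₀ v : ℂ) = A.f₀C (toC v) := by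
    intro v
    conv_lhs => rw [← Finset.univ_sum_single v, map_sum, Complex.ofReal_sum]
    refine Finset.sum_congr rfl fun i _ => ?_
    rw [← mul_one (v i), ← smul_eq_mul, Pi.single_smul, map_smul, smul_eq_mul, Complex.ofReal_mul]
    simp [toC]
  rw [hf₀, hf₀]
  simp only [f₀C, F, Pi.add_apply, Pi.smul_apply, smul_eq_mul, add_mul, Finset.sum_add_distrib,
    Finset.mul_sum, mul_assoc]

theorem F_ofReal (X : A.Vertex) (t : ℝ) (x : Fin k → ℝ) :
    A.F X t x = toC (A.pt X + t • (x - A.pt X)) := by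
  ext i
  simp [F, toC]

theorem F_ofReal_mul (X : A.Vertex) (t : ℝ) (w : ℂ) (x : Fin k → ℝ) :
    A.F X (t * w) x = A.F X w (A.pt X + t • (x - A.pt X)) := by
  ext i
  simp [F, toC]
  ring

theorem differentiable_F (X : A.Vertex) (x : Fin k → ℝ) :
    Differentiable ℂ fun w => A.F X w x := by
  unfold F
  fun_prop

theorem continuous_F (X : A.Vertex) (w : ℂ) : Continuous (A.F X w) := by
  unfold F toC
  fun_prop

theorem differentiable_fC (j : Fin N) : Differentiable ℂ (A.fC j) := by
  unfold fC
  fun_prop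

/-- A region of `ℂ^k`, containing `Δ_X` and the cones `C_X^ρ` with `ρ` not real, on which the
principal branches of the powers of `± f_j`, with the sign that makes `± f_j` positive on `Δ_X`, are
holomorphic. -/
def slitDomain (X : A.Vertex) : Set (Fin k → ℂ) :=
  {z | ∀ j, (A.sgn X j : ℂ) * A.fC j z ∈ Complex.slitPlane}

/-- The coefficient of the determination on `slitDomain X` of the form `Ω_{X'}`. -/
def branch (X X' : A.Vertex) (z : Fin k → ℂ) : ℂ :=
  (∏ j, ((A.sgn X j : ℂ) * A.fC j z) ^ (A.α j : ℂ)) *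
    ((A.vol X' : ℂ) * (∏ j ∈ X'.1, A.fC j z)⁻¹)

theorem isOpen_slitDomain (X : A.Vertex) : IsOpen (A.slitDomain X) := by
  simp only [slitDomain, Set.ofPred_forall]
  exact isOpen_iInter_of_finite fun j => Complex.isOpen_slitPlane.preimage
    (continuous_const.mul (A.differentiable_fC j).continuous)

theorem differentiableOn_branch (X X' : A.Vertex) :
    DifferentiableOn ℂ (A.branch X X') (A.slitDomain X) := by
  intro z hz
  have hne : ∀ j, A.fC j z ≠ 0 := fun j =>
    right_ne_zero_of_mul (Complex.slitPlane_ne_zero (hz j))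
  refine (DifferentiableAt.mul ?_ (DifferentiableAt.const_mul (DifferentiableAt.inv ?_ ?_)
    _)).differentiableWithinAt
  · exact differentiableAt_prod fun j _ =>
      ((A.differentiable_fC j z).const_mul _).cpow (differentiableAt_const _) (hz j)
  · exact differentiableAt_prod fun j _ => A.differentiable_fC j z
  · exact Finset.prod_ne_zero_iff.2 fun j _ => hne j

theorem toC_mem_slitDomain (X : A.Vertex) {x : Fin k → ℝ} (hx : x ∈ A.baseDomain X) :
    toC x ∈ A.slitDomain X := by
  intro j
  rw [fC_toC, ← Complex.ofReal_mul]
  exact Complex.ofReal_mem_slitPlane.2 ((A.mem_baseDomain_iff X x).1 hx j)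

theorem branch_toC (X X' : A.Vertex) {x : Fin k → ℝ} (hx : x ∈ A.baseDomain X) :
    A.branch X X' (toC x) = (A.Ω X' x : ℂ) := by
  rw [A.mem_baseDomain_iff] at hx
  simp only [branch, A.fC_toC, Ω, div_eq_mul_inv]
  push_cast
  congr 1
  refine Finset.prod_congr rfl fun j _ => ?_
  rw [← Complex.ofReal_mul, ← Complex.ofReal_cpow (hx j).le, ← abs_of_pos (hx j), abs_mul,
    A.abs_sgn, one_mul]

theorem sgn_mul_fC_F (X : A.Vertex) (w : ℂ) (x : Fin k → ℝ) (j : Fin N) :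
    (A.sgn X j : ℂ) * A.fC j (A.F X w x) =
      (A.sgn X j * A.f j (A.pt X) : ℝ) + w * (A.sgn X j * A.l j (x - A.pt X) : ℝ) := by
  rw [fC_F]
  push_cast
  ring

theorem F_mem_slitDomain (X : A.Vertex) {x : Fin k → ℝ} (hx : x ∈ A.cone X) {w : ℂ}
    (hw : w.im ≠ 0) : A.F X w x ∈ A.slitDomain X := by
  intro j
  rw [sgn_mul_fC_F]
  refine ofReal_add_mul_ofReal_mem_slitPlane hw fun hl => A.sgn_mul_f_pt_pos X fun hj => ?_
  rw [← A.f_eq_l_sub X hj] at hl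
  exact ((A.mem_cone_iff X x).1 hx j hj).ne' hl

theorem eventually_mem_baseDomain (X : A.Vertex) {x : Fin k → ℝ} (hx : x ∈ A.cone X) :
    ∀ᶠ t : ℝ in 𝓝[>] 0, A.pt X + t • (x - A.pt X) ∈ A.baseDomain X := by
  filter_upwards [A.eventually_ray X (x - A.pt X), self_mem_nhdsWithin] with t ht ht0
  rw [A.mem_baseDomain_iff]
  intro j
  by_cases hj : j ∈ X.1
  · exact (A.mem_cone_iff X _).1 ((A.homothety_mem_cone_iff X ht0 x).2 hx) j hj
  · rw [sgn_mul_pos_iff]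
    exact pos_of_mul (A.f_basePoint_mul_f_pt_pos X hj) (ht j hj)

theorem F_mem_of_coneC_subset {τ : ℝ} {D : Set (Fin k → ℂ)} (X : A.Vertex)
    (hD : ∀ ρ ∈ arc τ, A.coneC X ρ ⊆ D) {w : ℂ} (hw : w ∈ halfPlane τ) {x : Fin k → ℝ}
    (hx : x ∈ A.cone X) : A.F X w x ∈ D := by
  obtain ⟨r, hr, ρ, hρ, rfl⟩ := exists_mem_arc_eq_ofReal_mul hw
  refine hD ρ hρ ?_
  rw [F_ofReal_mul, ← A.image_F_cone]
  exact mem_image_of_mem _ ((A.homothety_mem_cone_iff X hr x).2 hx)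

theorem analyticOnNhd_comp_F (X : A.Vertex) (x : Fin k → ℝ) {D : Set (Fin k → ℂ)}
    (hD : IsOpen D) {G : (Fin k → ℂ) → ℂ} (hG : DifferentiableOn ℂ G D) {S : Set ℂ}
    (hS : ∀ w ∈ S, A.F X w x ∈ D) : AnalyticOnNhd ℂ (fun w => G (A.F X w x)) S :=
  ((hG.comp (A.differentiable_F X x).differentiableOn (mapsTo_preimage _ D)).analyticOnNhd
    (hD.preimage (A.differentiable_F X x).continuous)).mono hS

/- Both sides are analytic along the curve `w ↦ X + w (x - X)`, and they agree for small real
`w > 0`, where the curve runs inside `Δ_X`. -/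
theorem eq_branch_of_isExtension {τ : ℝ} (hτ : τ ≠ 0) {X X' : A.Vertex} {G : (Fin k → ℂ) → ℂ}
    (hG : A.IsExtension (arc τ) X X' G) {w : ℂ} (hw : w ∈ halfPlane τ) {x : Fin k → ℝ}
    (hx : x ∈ A.cone X) : G (A.F X w x) = A.branch X X' (A.F X w x) := by
  obtain ⟨D, hD, -, -, hcone, hbase, hGd, hGΩ⟩ := hG
  obtain ⟨ε, hε, hεb⟩ := mem_nhdsGT_iff_exists_Ioo_subset.1 (A.eventually_mem_baseDomain X hx)
  have hreal : ∀ t ∈ Ioo 0 ε, A.F X t x ∈ toC '' A.baseDomain X := fun t ht => by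
    rw [F_ofReal]
    exact mem_image_of_mem _ (hεb ht)
  refine eqOn_halfPlane_of_eq_on_Ioo hτ (mem_Ioi.1 hε)
    (A.analyticOnNhd_comp_F X x hD hGd ?_)
    (A.analyticOnNhd_comp_F X x (A.isOpen_slitDomain X) (A.differentiableOn_branch X X') ?_)
    (fun t ht => ?_) hw
  · rintro _ (hw | ⟨t, ht, rfl⟩)
    · exact A.F_mem_of_coneC_subset X hcone hw hx
    · exact image_subset_iff.2 hbase (hreal t ht)
  · rintro _ (hw | ⟨t, ht, rfl⟩)
    · exact A.F_mem_slitDomain X hx (im_ne_zero_of_mem_halfPlane hw)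
    · obtain ⟨y, hy, hyt⟩ := hreal t ht
      exact hyt ▸ A.toC_mem_slitDomain X hy
  · obtain ⟨y, hy, hyt⟩ := hreal t ht
    rw [← hyt, hGΩ y hy, A.branch_toC X X' hy]

theorem isExtension_ΩC (τ : ℝ) (X X' : A.Vertex) :
    A.IsExtension (arc τ) X X' (A.ΩC (arc τ) X X') := by
  have hex := A.exists_isExtension (arc τ) (fun ρ hρ => im_ne_zero_of_mem_halfPlane hρ.2) X X'
  unfold ΩC
  rw [dif_pos hex]
  exact hex.choose_spec

/-! ### Integrals over rotated cones -/

/-- The integrand of `I^w_{X,X'}(lam)`, pulled back to the real cone, for an arbitrary rotation and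
dilation factor `w`. -/
def rot (X X' : A.Vertex) (lam w : ℂ) (x : Fin k → ℝ) : ℂ :=
  Complex.exp (-lam * A.f₀C (A.F X w x)) * A.branch X X' (A.F X w x) * w ^ k

theorem integrandρ_eq_rot {τ : ℝ} (hτ : τ ≠ 0) (X X' : A.Vertex) (lam : ℂ) {ρ : ℂ}
    (hρ : ρ ∈ arc τ) {x : Fin k → ℝ} (hx : x ∈ A.cone X) :
    A.integrandρ (arc τ) ρ X X' lam x = A.rot X X' lam ρ x := by
  rw [integrandρ, rot, A.eq_branch_of_isExtension hτ (A.isExtension_ΩC τ X X') hρ.2 hx]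

theorem rot_ofReal_mul (X X' : A.Vertex) (lam w : ℂ) (t : ℝ) (x : Fin k → ℝ) :
    A.rot X X' lam (t * w) x =
      t ^ k • A.rot X X' lam w (A.pt X + t • (x - A.pt X)) := by
  rw [rot, rot, A.F_ofReal_mul, mul_pow, Complex.real_smul]
  push_cast
  ring

theorem rot_measurable (X X' : A.Vertex) (lam w : ℂ) : Measurable (A.rot X X' lam w) := by
  have hF : Measurable (A.F X w) := (A.continuous_F X w).measurable
  have hfC : ∀ j, Measurable fun x => A.fC j (A.F X w x) :=
    fun j => (A.differentiable_fC j).continuous.measurable.comp hF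
  have hf₀C : Measurable A.f₀C := by
    unfold f₀C
    fun_prop
  have hbranch : Measurable fun x => A.branch X X' (A.F X w x) := by
    unfold branch
    fun_prop
  unfold rot
  fun_prop

theorem differentiableAt_rot (X X' : A.Vertex) (lam : ℂ) {x : Fin k → ℝ} (hx : x ∈ A.cone X)
    {w : ℂ} (hw : w.im ≠ 0) : DifferentiableAt ℂ (fun w => A.rot X X' lam w x) w := by
  have hbranch : DifferentiableAt ℂ (fun w => A.branch X X' (A.F X w x)) w :=
    (A.analyticOnNhd_comp_F X x (A.isOpen_slitDomain X) (A.differentiableOn_branch X X')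
      (S := {w | w.im ≠ 0}) (fun w hw => A.F_mem_slitDomain X hx hw) w hw).differentiableAt
  simp only [rot, f₀C_F]
  fun_prop

theorem norm_branch (X X' : A.Vertex) (z : Fin k → ℂ) :
    ‖A.branch X X' z‖ = A.vol X' * A.modulus X' fun j => ‖A.fC j z‖ := by
  have hvol : |A.vol X'| = A.vol X' := abs_of_nonneg (abs_nonneg _)
  simp only [branch, modulus, norm_mul, norm_prod, norm_inv, Complex.norm_cpow_real,
    Complex.norm_real, Real.norm_eq_abs, A.abs_sgn, one_mul, hvol]
  ring

theorem exists_norm_fC_F_le (X : A.Vertex) {B : ℝ} (hB : 0 ≤ B) : ∃ M, 0 ≤ M ∧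
    ∀ w : ℂ, ‖w‖ ≤ B → ∀ j x, ‖A.fC j (A.F X w x)‖ ≤ M * (1 + ‖x‖) := by
  obtain ⟨M, hM, hf⟩ := A.exists_abs_f_le
  refine ⟨(1 + B) * (M * (1 + ‖A.pt X‖)) + B * M, by positivity, fun w hw j x => ?_⟩
  have hsplit : A.fC j (A.F X w x) = (1 - w) * (A.f j (A.pt X) : ℂ) + w * (A.f j x : ℂ) := by
    have h := A.f_add j (A.pt X) (x - A.pt X)
    rw [add_sub_cancel] at h
    rw [fC_F, h]
    push_cast
    ring
  calc ‖A.fC j (A.F X w x)‖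
      ≤ ‖1 - w‖ * |A.f j (A.pt X)| + ‖w‖ * |A.f j x| := by
        rw [hsplit]
        refine (norm_add_le _ _).trans_eq ?_
        simp only [norm_mul, Complex.norm_real, Real.norm_eq_abs]
    _ ≤ (1 + B) * (M * (1 + ‖A.pt X‖)) + B * (M * (1 + ‖x‖)) := by
        gcongr
        · exact (norm_sub_le _ _).trans (by rw [norm_one]; gcongr)
        · exact hf j _
        · exact hf j x
    _ ≤ ((1 + B) * (M * (1 + ‖A.pt X‖)) + B * M) * (1 + ‖x‖) := by
        have : 0 ≤ (1 + B) * (M * (1 + ‖A.pt X‖)) * ‖x‖ := by positivity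
        linarith

theorem exists_norm_exp_f₀C_F_le (X : A.Vertex) (lam : ℂ) {c : ℝ} (hc : 0 < c) :
    ∃ c' C : ℝ, 0 < c' ∧ 0 ≤ C ∧ ∀ w : ℂ, c ≤ (lam * w).re → ∀ x ∈ A.cone X,
      ‖Complex.exp (-lam * A.f₀C (A.F X w x))‖ ≤ C * Real.exp (-c' * ‖x‖) := by
  obtain ⟨κ, hκ, hcone⟩ := A.exists_mul_norm_le_f₀_of_mem_cone X
  refine ⟨c * κ, Real.exp (-lam.re * A.f₀ (A.pt X) + c * κ * ‖A.pt X‖), by positivity,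
    (Real.exp_pos _).le, fun w hw x hx => ?_⟩
  have hre : (-lam * A.f₀C (A.F X w x)).re =
      -lam.re * A.f₀ (A.pt X) - (lam * w).re * A.f₀ (x - A.pt X) := by
    rw [f₀C_F, mul_add, ← mul_assoc, neg_mul lam w, Complex.add_re, Complex.re_mul_ofReal,
      Complex.re_mul_ofReal, Complex.neg_re, Complex.neg_re]
    ring
  have hf₀ : c * κ * (‖x‖ - ‖A.pt X‖) ≤ (lam * w).re * A.f₀ (x - A.pt X) := calc
    c * κ * (‖x‖ - ‖A.pt X‖) ≤ c * (κ * ‖x - A.pt X‖) := by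
      rw [mul_assoc]
      gcongr
      exact norm_sub_norm_le _ _
    _ ≤ c * A.f₀ (x - A.pt X) := by gcongr; exact hcone x hx
    _ ≤ (lam * w).re * A.f₀ (x - A.pt X) :=
      mul_le_mul_of_nonneg_right hw ((by positivity : 0 ≤ κ * ‖x - A.pt X‖).trans (hcone x hx))
  rw [Complex.norm_exp, hre, ← Real.exp_add]
  exact Real.exp_le_exp.2 (by linarith)

theorem exists_norm_rot_le (X X' : A.Vertex) (lam : ℂ) {B R c : ℝ} (hB : 0 ≤ B) (hR : 0 ≤ R)
    (hc : 0 < c) : ∃ C c', 0 < c' ∧ ∀ w : ℂ, ‖w‖ ≤ B → ‖1 - w‖ ≤ R * |w.im| → c ≤ (lam * w).re →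
      ∀ x ∈ A.cone X, x ∈ A.compl → ‖A.rot X X' lam w x‖ ≤ C * A.dom c' X' x := by
  obtain ⟨c₁, E, hc₁, hE, hexp⟩ := A.exists_norm_exp_f₀C_F_le X lam hc
  obtain ⟨M, hM, hup⟩ := A.exists_norm_fC_F_le X hB
  obtain ⟨D, -, hD⟩ :=
    A.exists_exp_mul_modulus_le_dom X' (κ := (1 + R)⁻¹) (by positivity) hM hc₁
  have hvol : 0 ≤ A.vol X' := abs_nonneg _
  refine ⟨E * A.vol X' * B ^ k * D, c₁ / 2, half_pos hc₁, fun w hwB hwR hwc x hx hxc => ?_⟩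
  have hlow : ∀ j, (1 + R)⁻¹ * |A.f j x| ≤ ‖A.fC j (A.F X w x)‖ := fun j => by
    rw [inv_mul_le_iff₀ (by positivity), fC_F, ← add_sub_cancel (A.pt X) x, A.f_add,
      add_sub_cancel]
    exact abs_add_le_mul_norm_add_mul hR hwR _ _
  set Q := A.modulus X' fun j => ‖A.fC j (A.F X w x)‖
  have hQ : 0 ≤ Q := A.modulus_nonneg X' fun j => norm_nonneg _
  calc ‖A.rot X X' lam w x‖
      ≤ E * Real.exp (-c₁ * ‖x‖) * (A.vol X' * Q) * B ^ k := by
        rw [rot, norm_mul, norm_mul, norm_pow, norm_branch]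
        gcongr
        exact hexp w hwc x hx
    _ = E * A.vol X' * B ^ k * (Real.exp (-c₁ * ‖x‖) * Q) := by ring
    _ ≤ E * A.vol X' * B ^ k * (D * A.dom (c₁ / 2) X' x) :=
        mul_le_mul_of_nonneg_left (hD x _ hxc hlow fun j => hup w hwB j x) (by positivity)
    _ = E * A.vol X' * B ^ k * D * A.dom (c₁ / 2) X' x := by ring

theorem eventually_norm_rot_le (X X' : A.Vertex) {lam w₀ : ℂ} (him : w₀.im ≠ 0)
    (hre : 0 < (lam * w₀).re) : ∃ C c, 0 < c ∧ ∀ᶠ w in 𝓝 w₀, ∀ x ∈ A.cone X, x ∈ A.compl →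
      ‖A.rot X X' lam w x‖ ≤ C * A.dom c X' x := by
  have him₀ : 0 < |w₀.im| := abs_pos.2 him
  obtain ⟨C, c, hc, hC⟩ := A.exists_norm_rot_le X X' lam (B := ‖w₀‖ + 1)
    (R := ‖1 - w₀‖ / |w₀.im| + 1) (by positivity) (by positivity) (half_pos hre)
  have hB : ∀ᶠ w in 𝓝 w₀, ‖w‖ < ‖w₀‖ + 1 :=
    continuous_norm.continuousAt.eventually_lt_const (lt_add_one _)
  have hR : ∀ᶠ w in 𝓝 w₀, ‖1 - w‖ < (‖1 - w₀‖ / |w₀.im| + 1) * |w.im| := by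
    refine ContinuousAt.eventually_lt (by fun_prop) (by fun_prop) ?_
    rw [add_mul, div_mul_cancel₀ _ him₀.ne']
    linarith
  have hre' : ∀ᶠ w in 𝓝 w₀, (lam * w₀).re / 2 < (lam * w).re :=
    ContinuousAt.eventually_lt (by fun_prop) (by fun_prop) (half_lt_self hre)
  refine ⟨C, c, hc, ?_⟩
  filter_upwards [hB, hR, hre'] with w h₁ h₂ h₃
  exact hC w h₁.le h₂.le h₃.le

theorem ae_restrict_cone (X : A.Vertex) :
    ∀ᵐ x ∂volume.restrict (A.cone X), x ∈ A.cone X ∧ x ∈ A.compl :=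
  (ae_restrict_mem (A.isOpen_cone X).measurableSet).and (ae_restrict_of_ae A.ae_mem_compl)

theorem integrableOn_rot (X X' : A.Vertex) {lam w : ℂ} (him : w.im ≠ 0)
    (hre : 0 < (lam * w).re) : IntegrableOn (A.rot X X' lam w) (A.cone X) := by
  obtain ⟨C, c, hc, hC⟩ := A.eventually_norm_rot_le X X' him hre
  refine ((A.integrable_dom hc X').integrableOn.const_mul C).mono'
    (A.rot_measurable X X' lam w).aestronglyMeasurable ?_
  filter_upwards [A.ae_restrict_cone X] with x hx
  exact hC.self_of_nhds x hx.1 hx.2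

theorem differentiableAt_integral_rot (X X' : A.Vertex) {lam w₀ : ℂ} (him : w₀.im ≠ 0)
    (hre : 0 < (lam * w₀).re) :
    DifferentiableAt ℂ (fun w => ∫ x in A.cone X, A.rot X X' lam w x) w₀ := by
  obtain ⟨C, c, hc, hC⟩ := A.eventually_norm_rot_le X X' him hre
  have him' : ∀ᶠ w in 𝓝 w₀, w.im ≠ 0 := Complex.continuous_im.continuousAt.eventually_ne him
  refine differentiableAt_integral_of_dominated (hC.and him')
    (fun w => (A.rot_measurable X X' lam w).aestronglyMeasurable) ?_ ?_
    ((A.integrable_dom hc X').integrableOn.const_mul C)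
  · filter_upwards [A.ae_restrict_cone X] with x hx w hw
    exact (A.differentiableAt_rot X X' lam hx.1 hw.2).differentiableWithinAt
  · filter_upwards [A.ae_restrict_cone X] with x hx w hw
    exact hw.1 x hx.1 hx.2

theorem integral_rot_ofReal_mul (X X' : A.Vertex) (lam w : ℂ) {t : ℝ} (ht : 0 < t) :
    ∫ x in A.cone X, A.rot X X' lam (t * w) x = ∫ x in A.cone X, A.rot X X' lam w x := by
  have h := setIntegral_comp_homothety volume (A.rot X X' lam w)
    (A.isOpen_cone X).measurableSet ht (A.homothety_mem_cone_iff X ht)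
  rw [Module.finrank_fin_fun] at h
  rw [← h, ← integral_smul]
  simp only [rot_ofReal_mul]

theorem integral_rot_eq {τ : ℝ} (X X' : A.Vertex) {lam w w' : ℂ}
    (hw : w ∈ halfPlane τ) (hre : 0 < (lam * w).re) (hw' : w' ∈ halfPlane τ)
    (hre' : 0 < (lam * w').re) :
    ∫ x in A.cone X, A.rot X X' lam w x = ∫ x in A.cone X, A.rot X X' lam w' x := by
  have hopen : IsOpen {w : ℂ | 0 < (lam * w).re} := isOpen_lt continuous_const (by fun_prop)
  have hconv : Convex ℝ {w : ℂ | 0 < (lam * w).re} :=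
    (convex_Ioi (0 : ℝ)).linear_preimage
      (Complex.reLm ∘ₗ (LinearMap.mulLeft ℂ lam).restrictScalars ℝ)
  refine eq_of_differentiableOn_of_ofReal_mul_eq ((isOpen_halfPlane τ).inter hopen)
    ((convex_halfPlane τ).inter hconv).isPreconnected (by simp)
    (f := fun w => ∫ x in A.cone X, A.rot X X' lam w x)
    (fun w hw => ?_) (fun w _ r hr => A.integral_rot_ofReal_mul X X' lam w hr)
    ⟨hw, hre⟩ ⟨hw', hre'⟩
  exact (A.differentiableAt_integral_rot X X' (im_ne_zero_of_mem_halfPlane hw.1)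
    hw.2).differentiableWithinAt

/-! ### The domains inside a cone -/

variable {Δ : Set (Fin k → ℝ)}

theorem eq_component_of_mem (hΔ : Δ ∈ A.domains) {x : Fin k → ℝ} (hx : x ∈ Δ) :
    Δ = connectedComponentIn A.compl x := by
  obtain ⟨y, -, rfl⟩ := hΔ
  exact connectedComponentIn_eq hx

theorem mem_coneDomains (X : A.Vertex) :
    Δ ∈ A.coneDomains X ↔ Δ ∈ A.domainsPlus ∧ Δ ⊆ A.cone X := by
  simp [coneDomains]

theorem mem_domains_of_mem_coneDomains {X : A.Vertex} (hΔ : Δ ∈ A.coneDomains X) :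
    Δ ∈ A.domains :=
  ((A.mem_coneDomains X).1 hΔ).1.1

theorem component_mem_coneDomains (X : A.Vertex) {x : Fin k → ℝ} (hx : x ∈ A.cone X)
    (hxc : x ∈ A.compl) : connectedComponentIn A.compl x ∈ A.coneDomains X := by
  have hsub : connectedComponentIn A.compl x ⊆ A.cone X := fun y hy => by
    rw [mem_cone_iff] at hx ⊢
    intro j hj
    have hxj := hx j hj
    rw [sgn_mul_pos_iff] at hxj ⊢
    exact pos_of_mul hxj (mul_comm (A.f j x) (A.f j y) ▸ A.sign_of_mem hxc hy j)
  obtain ⟨κ, hκ, hf₀⟩ := A.exists_mul_norm_le_f₀_of_mem_cone X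
  refine (A.mem_coneDomains X).2 ⟨⟨⟨x, hxc, rfl⟩, A.f₀ (A.pt X), ?_⟩, hsub⟩
  rintro _ ⟨y, hy, rfl⟩
  have hle : 0 ≤ A.f₀ (y - A.pt X) := (by positivity : 0 ≤ κ * _).trans (hf₀ y (hsub hy))
  rwa [map_sub, sub_nonneg] at hle

theorem cone_ae_eq_biUnion (X : A.Vertex) :
    A.cone X =ᵐ[volume] (⋃ Δ ∈ A.coneDomains X, Δ : Set (Fin k → ℝ)) := by
  filter_upwards [A.ae_mem_compl] with x hx
  refine propext ⟨fun h => ?_, fun h => ?_⟩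
  · exact mem_biUnion (A.component_mem_coneDomains X h hx) (mem_connectedComponentIn hx)
  · obtain ⟨Δ, hΔ, hxΔ⟩ := mem_iUnion₂.1 h
    exact ((A.mem_coneDomains X).1 hΔ).2 hxΔ

theorem setIntegral_cone_eq_sum (X : A.Vertex) {g : (Fin k → ℝ) → ℂ}
    (hg : IntegrableOn g (A.cone X)) :
    ∫ x in A.cone X, g x = ∑ Δ ∈ A.coneDomains X, ∫ x in Δ, g x := by
  rw [setIntegral_congr_set (A.cone_ae_eq_biUnion X)]
  refine integral_biUnion_finset _
    (fun Δ hΔ => (A.isOpen_of_mem_domains (A.mem_domains_of_mem_coneDomains hΔ)).measurableSet)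
    (fun Δ hΔ Δ' hΔ' hne => disjoint_left.2 fun x hx hx' => hne ?_)
    fun Δ hΔ => hg.mono_set ((A.mem_coneDomains X).1 hΔ).2
  rw [A.eq_component_of_mem (A.mem_domains_of_mem_coneDomains hΔ) hx,
    A.eq_component_of_mem (A.mem_domains_of_mem_coneDomains hΔ') hx']

theorem mem_sep_baseDomain_iff (X : A.Vertex) (hΔ : Δ ∈ A.domains) {x : Fin k → ℝ} (hx : x ∈ Δ)
    (j : Fin N) : j ∈ A.sep Δ (A.baseDomain X) ↔ A.sgn X j * A.f j x < 0 := by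
  have hsgn : A.sgn X j * A.f j x < 0 ↔ A.f j x * A.f j (A.basePoint X) < 0 := by
    rw [← neg_pos, ← mul_neg, sgn_mul_pos_iff, mul_neg, neg_pos, mul_comm]
  rw [hsgn]
  simp only [sep, Finset.mem_filter, Finset.mem_univ, true_and]
  refine ⟨fun h => h x hx _ (A.basePoint_mem_baseDomain X), fun h y hy z hz => ?_⟩
  have hxy : 0 < A.f j x * A.f j y := by
    rw [A.eq_component_of_mem hΔ hx] at hy
    exact A.sign_of_mem (A.subset_compl_of_mem_domains hΔ hx) hy j
  have hz' : 0 < A.f j (A.basePoint X) * A.f j z :=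
    (A.sgn_mul_pos_iff X j _).1 ((A.mem_baseDomain_iff X z).1 hz j)
  rw [← neg_pos, ← mul_neg] at h ⊢
  rw [mul_comm] at hxy
  nlinarith [mul_pos (mul_pos hxy h) hz']

/-! ### The limit of the rotated cones -/

/-- The factor acquired by the determination of `Ω` when the hyperplanes of `U` are crossed, the
crossing being on the side of `ℂ^k` that contains the cones rotated by `w ∈ halfPlane τ`. -/
def phase (τ : ℝ) (U : Finset (Fin N)) : ℂ :=
  Complex.exp (-τ * (Real.pi * Complex.I) * (A.αSum U : ℂ))

theorem phase_eq_prod (τ : ℝ) (U : Finset (Fin N)) : A.phase τ U =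
    ∏ j, if j ∈ U then Complex.exp (-τ * (Real.pi * Complex.I) * (A.α j : ℂ)) else 1 := by
  rw [phase, αSum, Complex.ofReal_sum, Finset.mul_sum, Complex.exp_sum, Finset.prod_ite_mem,
    Finset.univ_inter]

theorem tendsto_F (X : A.Vertex) (x : Fin k → ℝ) (S : Set ℂ) :
    Tendsto (fun w => A.F X w x) (𝓝[S] 1) (𝓝 (toC x)) := by
  have h := ((A.differentiable_F X x).continuous.tendsto 1).mono_left
    (nhdsWithin_le_nhds (s := S))
  rwa [← Complex.ofReal_one, F_ofReal, one_smul, add_sub_cancel, Complex.ofReal_one] at h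

theorem mul_im_sgn_mul_fC_F_neg {τ : ℝ} (X : A.Vertex) {x : Fin k → ℝ} {j : Fin N}
    (hneg : A.sgn X j * A.f j x < 0) {w : ℂ} (hw : w ∈ halfPlane τ) :
    τ * ((A.sgn X j : ℂ) * A.fC j (A.F X w x)).im < 0 := by
  have hpt : 0 ≤ A.sgn X j * A.f j (A.pt X) := by
    by_cases hj : j ∈ X.1
    · rw [A.f_pt X hj, mul_zero]
    · exact (A.sgn_mul_f_pt_pos X hj).le
  have hl : A.sgn X j * A.l j (x - A.pt X) < 0 := by
    rw [← add_sub_cancel (A.pt X) x, f_add, mul_add] at hneg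
    linarith
  rw [sgn_mul_fC_F, Complex.add_im, Complex.ofReal_im, zero_add, Complex.im_mul_ofReal,
    ← mul_assoc]
  exact mul_neg_of_pos_of_neg hw hl

theorem tendsto_sgn_mul_fC_F_cpow {τ : ℝ} (hτ : τ = 1 ∨ τ = -1) (X : A.Vertex)
    (hΔ : Δ ∈ A.domains) {x : Fin k → ℝ} (hx : x ∈ Δ) (j : Fin N) :
    Tendsto (fun w => ((A.sgn X j : ℂ) * A.fC j (A.F X w x)) ^ (A.α j : ℂ)) (𝓝[halfPlane τ] 1)
      (𝓝 (((|A.f j x| ^ A.α j : ℝ) : ℂ) * if j ∈ A.sep Δ (A.baseDomain X) then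
        Complex.exp (-τ * (Real.pi * Complex.I) * (A.α j : ℂ)) else 1)) := by
  have hlim : Tendsto (fun w => (A.sgn X j : ℂ) * A.fC j (A.F X w x)) (𝓝[halfPlane τ] 1)
      (𝓝 (A.sgn X j * A.f j x : ℝ)) := by
    rw [Complex.ofReal_mul, ← fC_toC]
    exact (((A.differentiable_fC j).continuous.tendsto _).comp (A.tendsto_F X x _)).const_mul _
  have habs : |A.f j x| = |A.sgn X j * A.f j x| := by rw [abs_mul, A.abs_sgn, one_mul]
  simp only [A.mem_sep_baseDomain_iff X hΔ hx]
  split_ifs with hneg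
  · rw [habs, abs_of_neg hneg, Complex.ofReal_cpow (neg_pos.2 hneg).le, Complex.ofReal_neg]
    refine ((hlim.neg.cpow tendsto_const_nhds ?_).mul_const _).congr' ?_
    · rw [← Complex.ofReal_neg]
      exact Complex.ofReal_mem_slitPlane.2 (neg_pos.2 hneg)
    · filter_upwards [self_mem_nhdsWithin] with w hw
      exact (cpow_eq_neg_cpow_mul_exp hτ (A.mul_im_sgn_mul_fC_F_neg X hneg hw) _).symm
  · have hpos : 0 < A.sgn X j * A.f j x := (not_lt.1 hneg).lt_of_ne'
      (mul_ne_zero (A.sgn_ne_zero X j) (A.subset_compl_of_mem_domains hΔ hx j))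
    rw [mul_one, habs, abs_of_pos hpos, Complex.ofReal_cpow hpos.le]
    exact hlim.cpow tendsto_const_nhds (Complex.ofReal_mem_slitPlane.2 hpos)

theorem tendsto_branch {τ : ℝ} (hτ : τ = 1 ∨ τ = -1) (X X' : A.Vertex)
    (hΔ : Δ ∈ A.domains) {x : Fin k → ℝ} (hx : x ∈ Δ) :
    Tendsto (fun w => A.branch X X' (A.F X w x)) (𝓝[halfPlane τ] 1)
      (𝓝 (A.phase τ (A.sep Δ (A.baseDomain X)) * (A.Ω X' x : ℂ))) := by
  have hxc := A.subset_compl_of_mem_domains hΔ hx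
  have hpow := tendsto_finsetProd Finset.univ fun j _ =>
    A.tendsto_sgn_mul_fC_F_cpow hτ X hΔ hx j
  have hprod : Tendsto (fun w => (∏ j ∈ X'.1, A.fC j (A.F X w x))⁻¹) (𝓝[halfPlane τ] 1)
      (𝓝 (∏ j ∈ X'.1, (A.f j x : ℂ))⁻¹) := by
    refine (tendsto_finsetProd _ fun j _ => ?_).inv₀
      (Finset.prod_ne_zero_iff.2 fun j _ => Complex.ofReal_ne_zero.2 (hxc j))
    rw [← fC_toC]
    exact ((A.differentiable_fC j).continuous.tendsto _).comp (A.tendsto_F X x _)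
  rw [Finset.prod_mul_distrib, ← phase_eq_prod] at hpow
  convert hpow.mul (hprod.const_mul (A.vol X' : ℂ)) using 2
  · rfl
  · simp only [Ω]
    push_cast
    ring

theorem tendsto_rot {τ : ℝ} (hτ : τ = 1 ∨ τ = -1) (X X' : A.Vertex) (lam : ℂ)
    (hΔ : Δ ∈ A.domains) {x : Fin k → ℝ} (hx : x ∈ Δ) :
    Tendsto (fun w => A.rot X X' lam w x) (𝓝[halfPlane τ] 1)
      (𝓝 (A.phase τ (A.sep Δ (A.baseDomain X)) * A.integrand X' lam x)) := by
  have hexp : Tendsto (fun w => Complex.exp (-lam * A.f₀C (A.F X w x)) * w ^ k)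
      (𝓝[halfPlane τ] 1) (𝓝 (Complex.exp (-lam * (A.f₀ x : ℂ)))) := by
    have hcont : Continuous fun w => Complex.exp (-lam * A.f₀C (A.F X w x)) * w ^ k := by
      simp only [f₀C_F]
      fun_prop
    have h := (hcont.tendsto 1).mono_left (nhdsWithin_le_nhds (s := halfPlane τ))
    rwa [f₀C_F, one_mul, one_pow, mul_one, ← Complex.ofReal_add, ← map_add, add_sub_cancel] at h
  convert hexp.mul (A.tendsto_branch hτ X X' hΔ hx) using 2 with w
  · rw [rot]
    ring
  · rw [integrand]
    ring

/- On the path `w = 1 + s τ i`, `s → 0⁺`, one has `‖1 - w‖ = |Im w|`, so the bound of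
`exists_norm_rot_le` is uniform. -/
theorem tendsto_setIntegral_rot {τ : ℝ} (hτ : τ = 1 ∨ τ = -1) (X X' : A.Vertex) {lam : ℂ}
    (hlam : 0 < lam.re) (hΔ : Δ ∈ A.coneDomains X) :
    Tendsto (fun s : ℝ => ∫ x in Δ, A.rot X X' lam (1 + (s * τ : ℝ) * Complex.I) x) (𝓝[>] 0)
      (𝓝 (A.phase τ (A.sep Δ (A.baseDomain X)) * A.IΔ Δ lam X')) := by
  have hΔ' := A.mem_domains_of_mem_coneDomains hΔ
  have hms := (A.isOpen_of_mem_domains hΔ').measurableSet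
  have hpath := tendsto_one_add_mul_I_halfPlane (ne_zero_of_eq_one_or hτ)
  obtain ⟨C, c, hc, hC⟩ := A.exists_norm_rot_le X X' lam (B := 2) (R := 1) (c := lam.re / 2)
    zero_le_two zero_le_one (half_pos hlam)
  have hB : ∀ᶠ w in 𝓝[halfPlane τ] (1 : ℂ), ‖w‖ < 2 ∧ lam.re / 2 < (lam * w).re := by
    refine Eventually.filter_mono nhdsWithin_le_nhds (Eventually.and ?_ ?_)
    · exact ContinuousAt.eventually_lt (by fun_prop) (by fun_prop) (by simp)
    · exact ContinuousAt.eventually_lt (by fun_prop) (by fun_prop) (by simpa)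
  rw [IΔ, ← integral_const_mul]
  refine tendsto_integral_filter_of_dominated_convergence (fun x => C * A.dom c X' x)
    (.of_forall fun s => (A.rot_measurable X X' lam _).aestronglyMeasurable) ?_
    ((A.integrable_dom hc X').integrableOn.const_mul C) ?_
  · filter_upwards [hpath.eventually hB] with s hs
    filter_upwards [ae_restrict_mem hms] with x hx
    refine hC _ hs.1.le ?_ hs.2.le x (((A.mem_coneDomains X).1 hΔ).2 hx)
      (A.subset_compl_of_mem_domains hΔ' hx)
    simp [abs_mul]
  · filter_upwards [ae_restrict_mem hms] with x hx
    exact (A.tendsto_rot hτ X X' lam hΔ' hx).comp hpath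

theorem integral_rot_eq_sum {τ : ℝ} (hτ : τ = 1 ∨ τ = -1) (X X' : A.Vertex) {lam w : ℂ}
    (hlam : 0 < lam.re) (hw : w ∈ halfPlane τ) (hre : 0 < (lam * w).re) :
    ∫ x in A.cone X, A.rot X X' lam w x =
      ∑ Δ ∈ A.coneDomains X, A.phase τ (A.sep Δ (A.baseDomain X)) * A.IΔ Δ lam X' := by
  have hpath := tendsto_one_add_mul_I_halfPlane (ne_zero_of_eq_one_or hτ)
  have hre' : ∀ᶠ w in 𝓝[halfPlane τ] (1 : ℂ), 0 < (lam * w).re :=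
    Eventually.filter_mono nhdsWithin_le_nhds
      (ContinuousAt.eventually_lt (by fun_prop) (by fun_prop) (by simpa))
  refine tendsto_nhds_unique (tendsto_const_nhds.congr' ?_)
    (tendsto_finsetSum _ fun Δ hΔ => A.tendsto_setIntegral_rot hτ X X' hlam hΔ)
  filter_upwards [hpath.eventually (hre'.and self_mem_nhdsWithin)] with s hs
  rw [A.integral_rot_eq X X' hw hre hs.2 hs.1, A.setIntegral_cone_eq_sum X
    (A.integrableOn_rot X X' (im_ne_zero_of_mem_halfPlane hs.2) hs.1)]

/-! ### The common values -/

theorem lowerArc_eq_arc : lowerArc = arc (-1) := by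
  ext ρ
  simp [lowerArc, arc, halfPlane]

theorem upperArc_eq_arc : upperArc = arc 1 := by
  ext ρ
  simp [upperArc, arc, halfPlane]

theorem sep_baseDomain_self (X : A.Vertex) : A.sep (A.baseDomain X) (A.baseDomain X) = ∅ := by
  refine Finset.eq_empty_of_forall_notMem fun j hj => ?_
  rw [A.mem_sep_baseDomain_iff X (A.baseDomain_spec X).1 (A.basePoint_mem_baseDomain X)] at hj
  exact hj.not_gt ((A.mem_baseDomain_iff X _).1 (A.basePoint_mem_baseDomain X) j)

theorem phase_neg_one_sep (X : A.Vertex) (Δ : Set (Fin k → ℝ)) :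
    A.phase (-1) (A.sep Δ (A.baseDomain X)) = A.η X Δ := by
  unfold η
  split_ifs with h
  · simp [h, A.sep_baseDomain_self, phase, αSum]
  · simp [phase]

theorem phase_one_sep (X : A.Vertex) (Δ : Set (Fin k → ℝ)) :
    A.phase 1 (A.sep Δ (A.baseDomain X)) = (starRingEnd ℂ) (A.η X Δ) := by
  rw [← phase_neg_one_sep, phase, phase, ← Complex.exp_conj]
  simp

theorem isCommonValue_arc {τ : ℝ} (hτ : τ = 1 ∨ τ = -1) (X X' : A.Vertex) {lam : ℂ}
    (hlam : 0 < lam.re) : A.IsCommonValue (arc τ) X X' lam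
      (∑ Δ ∈ A.coneDomains X, A.phase τ (A.sep Δ (A.baseDomain X)) * A.IΔ Δ lam X') := by
  intro ρ hρ hre
  rw [mul_comm] at hre
  have hms := (A.isOpen_cone X).measurableSet
  have heq : EqOn (A.integrandρ (arc τ) ρ X X' lam) (A.rot X X' lam ρ) (A.cone X) :=
    fun x hx => A.integrandρ_eq_rot (ne_zero_of_eq_one_or hτ) X X' lam hρ hx
  refine ⟨(A.integrableOn_rot X X' (im_ne_zero_of_mem_halfPlane hρ.2) hre).congr_fun heq.symm
    hms, ?_⟩
  rw [Iρ, setIntegral_congr_fun hms heq, A.integral_rot_eq_sum hτ X X' hlam hρ.2 hre]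

theorem exists_mem_arc_re_mul_pos {τ : ℝ} (hτ : τ ≠ 0) {lam : ℂ} (hlam : 0 < lam.re) :
    ∃ ρ ∈ arc τ, 0 < (ρ * lam).re := by
  have hpath := tendsto_one_add_mul_I_halfPlane hτ
  have hre : ∀ᶠ w in 𝓝[halfPlane τ] (1 : ℂ), 0 < (w * lam).re :=
    Eventually.filter_mono nhdsWithin_le_nhds
      (ContinuousAt.eventually_lt (by fun_prop) (by fun_prop) (by simpa))
  obtain ⟨s, hs, hsτ⟩ := (hpath.eventually (hre.and self_mem_nhdsWithin)).exists
  obtain ⟨r, hr, ρ, hρ, hsρ⟩ := exists_mem_arc_eq_ofReal_mul hsτ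
  refine ⟨ρ, hρ, ?_⟩
  rw [hsρ, mul_assoc, Complex.re_ofReal_mul] at hs
  exact pos_of_mul_pos_right hs hr.le

theorem commonValue_eq {R : Set ℂ} {X X' : A.Vertex} {lam c : ℂ}
    (hR : ∃ ρ ∈ R, 0 < (ρ * lam).re) (hc : A.IsCommonValue R X X' lam c) :
    A.commonValue R X X' lam = c := by
  have hex : ∃ c, A.IsCommonValue R X X' lam c := ⟨c, hc⟩
  obtain ⟨ρ, hρ, hre⟩ := hR
  unfold commonValue
  rw [dif_pos hex, ← (hex.choose_spec ρ hρ hre).2, (hc ρ hρ hre).2]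

theorem IPlus_apply (X X' : A.Vertex) {lam : ℂ} (hlam : 0 < lam.re) :
    A.IPlus X lam X' = ∑ Δ ∈ A.coneDomains X, A.η X Δ * A.IΔ Δ lam X' := by
  rw [IPlus, lowerArc_eq_arc, A.commonValue_eq (exists_mem_arc_re_mul_pos (by norm_num) hlam)
    (A.isCommonValue_arc (Or.inr rfl) X X' hlam)]
  simp only [phase_neg_one_sep]

theorem IMinus_apply (X X' : A.Vertex) {lam : ℂ} (hlam : 0 < lam.re) :
    A.IMinus X lam X' =
      ∑ Δ ∈ A.coneDomains X, (starRingEnd ℂ) (A.η X Δ) * A.IΔ Δ lam X' := by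
  rw [IMinus, upperArc_eq_arc, A.commonValue_eq (exists_mem_arc_re_mul_pos one_ne_zero hlam)
    (A.isCommonValue_arc (Or.inl rfl) X X' hlam)]
  simp only [phase_one_sep]

theorem isCommonValue_IPlus (X X' : A.Vertex) {lam : ℂ} (hlam : 0 < lam.re) :
    A.IsCommonValue lowerArc X X' lam (A.IPlus X lam X') := by
  rw [A.IPlus_apply X X' hlam, lowerArc_eq_arc]
  simpa only [phase_neg_one_sep] using A.isCommonValue_arc (Or.inr rfl) X X' hlam

theorem isCommonValue_IMinus (X X' : A.Vertex) {lam : ℂ} (hlam : 0 < lam.re) :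
    A.IsCommonValue upperArc X X' lam (A.IMinus X lam X') := by
  rw [A.IMinus_apply X X' hlam, upperArc_eq_arc]
  simpa only [phase_one_sep] using A.isCommonValue_arc (Or.inl rfl) X X' hlam

end Arrangement

end HypArr

end

theorem lemma2 {k N : ℕ} (A : HypArr.Arrangement k N) (X : A.Vertex) (lam : ℂ)
    (hlam : 0 < lam.re) :
    (∀ Δ ∈ A.domainsPlus, ∀ X' : A.Vertex,
      MeasureTheory.IntegrableOn (A.integrand X' lam) Δ) ∧
    (∀ X' : A.Vertex,
      A.IsCommonValue HypArr.Arrangement.lowerArc X X' lam (A.IPlus X lam X') ∧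
      A.IsCommonValue HypArr.Arrangement.upperArc X X' lam (A.IMinus X lam X')) ∧
    A.IPlus X lam = ∑ Δ ∈ A.coneDomains X, A.η X Δ • A.IΔ Δ lam ∧
    A.IMinus X lam =
      ∑ Δ ∈ A.coneDomains X, (starRingEnd ℂ) (A.η X Δ) • A.IΔ Δ lam := by
  refine ⟨fun Δ hΔ X' => A.integrableOn_integrand hΔ X' hlam,
    fun X' => ⟨A.isCommonValue_IPlus X X' hlam, A.isCommonValue_IMinus X X' hlam⟩,
    funext fun X' => ?_, funext fun X' => ?_⟩
  · simp only [A.IPlus_apply X X' hlam, Finset.sum_apply, Pi.smul_apply, smul_eq_mul]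
  · simp only [A.IMinus_apply X X' hlam, Finset.sum_apply, Pi.smul_apply, smul_eq_mul]
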